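/- **Setting.** Let $\mathbf{T}^2=\mathbf{R}^2/\mathbf{Z}^2$. Let $\rho\in\mathcal{C}^\infty(\mathbf{R}^2)$ be nonnegative and even, with $\operatorname{supp}\rho\subset(-\frac12,\frac12)^2$ and $\|\rho\|_{L^1}=1$. For $\varepsilon\in(0,1)$ let $\rho^\varepsilon(x)=\varepsilon^{-2}\rho(\varepsilon^{-1}x)$, regarded as a function on $\mathbf{T}^2$ by periodic extension, and let $R^\varepsilon=\rho^\varepsilon*\rho^\varepsilon$ (convolution on $\mathbf{T}^2$). For $t\ge 0$ and paths $X,Y\in\mathcal{C}([0,t];\mathbf{T}^2)$ define the intersection time $$\mathscr{I}^\varepsilon_t[X,Y]=\int_0^tR^\varepsilon(X(s)-Y(s))\,\mathrm{d}s .$$ Let $W$ be a standard space-time white noise on $[0,t]\times\mathbf{T}^2$, defined on a probability space with expectation $\mathbf{E}$ (its Wiener integrals being taken in a jointly measurable version). For $x\in\mathbf{T}^2$ let $\mathbb{P}_{X^{t,x}}$, with expectation $\mathbb{E}_{X^{t,x}}$, be the law on $\mathcal{C}([0,t];\mathbf{T}^2)$ of a standard Brownian motion $X$ on $\mathbf{T}^2$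 running backwards in time with $X(t)=x$. For $\theta\ge 0$ let $$\mathscr{E}[W,X]=\exp\Big\{\theta^{\frac12}|\log\varepsilon|^{-\frac12}\int_0^t\!\!\int_{\mathbf{T}^2}\rho^\varepsilon(X(s)-y)\,W(\mathrm{d}y\,\mathrm{d}s)-|\log\varepsilon|^{-\frac12}\kappa\Big\},$$ where $\kappa=\kappa^\varepsilon_\theta(t)$ is the deterministic constant $$\kappa=|\log\varepsilon|^{\frac12}\,\mathbf{E}\log\mathbb{E}_{X^{t,x}}\exp\Big\{\theta^{\frac12}|\log\varepsilon|^{-\frac12}\int_0^t\!\!\int_{\mathbf{T}^2}\rho^\varepsilon(X(s)-y)\,W(\mathrm{d}y\,\mathrm{d}s)\Big\}.$$ Let $\widehat{\mathbb{P}}^{\theta,W,\varepsilon}_{X^{t,x}}$ be the (random) tilted probability measure with density $\mathscr{E}[W,X]/\mathbb{E}_{X^{t,x}}\mathscr{E}[W,X]$ with respect to $\mathbb{P}_{X^{t,x}}$. Let $J\ge 0$ be an integer and $\mathbf{x}=(x_1,\dots,x_J)\in(\mathbf{T}^2)^J$. Let $\underline{\mathbf{X}}=(\mathbf{X}_0,\mathbf{X}_1,\mathbf{X}_2)$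 with $\mathbf{X}_\alpha=(X_{\alpha;1},\dots,X_{\alpha;J})$, and let $\widehat{\mathbb{E}}^{\theta,W,\varepsilon}_{\underline{\mathbf{X}}}$ denote expectation under the product measure for which the $3J$ paths $X_{\alpha;j}$ are independent and $X_{\alpha;j}$ has law $\widehat{\mathbb{P}}^{\theta,W,\varepsilon}_{X^{t,x_j}}$. For measurable $\mathscr{Q}:\mathcal{C}([0,t];\mathbf{T}^2)^J\to\mathbf{R}$ with $\mathscr{Q}$ integrable under $\mathbb{P}_{X^{t,x_1}}\otimes\dots\otimes\mathbb{P}_{X^{t,x_J}}$, and for real $r\ge0$, $\theta\ge0$, set $$G_{r,\mathscr{Q}}(\theta)=|\log\varepsilon|^{-r}\sum_{\alpha,\beta=0}^{2}\ \sum_{j,k=1}^{J}\mathbf{1}_{(\alpha,j)\neq(\beta,k)}\ \mathbf{E}\,\widehat{\mathbb{E}}^{\theta,W,\varepsilon}_{\underline{\mathbf{X}}}\big(\mathscr{Q}[\mathbf{X}_0]\,\mathscr{I}^\varepsilon_t[X_{\alpha;j},X_{\beta;k}]^{r}\big)$$ (with $0^0=1$), and let $|\mathscr{Q}|[\mathbf{X}_0]=|\mathscr{Q}[\mathbf{X}_0]|$.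 **Claim.** For every $J$ there is a constant $C(J)>0$, depending only on $J$ (and not on $\rho,\varepsilon,t,\mathbf{x},\mathscr{Q},r,\theta$ or the underlying probability space), such that for all $r\ge0$ and $\theta\ge0$ the following hold. 1. For every measurable $\mathscr{Q}$ that is integrable as above, $G_{r,\mathscr{Q}}$ is differentiable at $\theta$ as a function on $[0,\infty)$ (one-sidedly at $\theta=0$), and $$|G'_{r,\mathscr{Q}}(\theta)|\le C(J)\,G_{r+1,|\mathscr{Q}|}(\theta).$$ 2. For every bounded measurable $\mathscr{Q}$, the following series converges and $$G_{r,\mathscr{Q}}(\theta)\le\sum_{j=0}^{\infty}\frac{(C(J)\theta)^j}{j!}\,G_{r+j,|\mathscr{Q}|}(0).$$ -/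

import Mathlib

open MeasureTheory ProbabilityTheory Set
open scoped NNReal ENNReal

noncomputable section

namespace KPZ

/-- The two-dimensional torus `ℝ² / ℤ²`; its `volume` is Lebesgue measure, of total mass one. -/
abbrev Torus : Type := UnitAddTorus (Fin 2)

/-- A mollifier on `ℝ²`: a smooth, nonnegative, even function with integral one whose support
lies in the open square `(-1/2, 1/2)²`. -/
structure Mollifier where
  toFun : (Fin 2 → ℝ) → ℝ
  smooth : ContDiff ℝ ((⊤ : ℕ∞) : WithTop ℕ∞) toFun
  nonneg : ∀ x, 0 ≤ toFun x
  even : ∀ x, toFun (-x) = toFun x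
  support_subset : tsupport toFun ⊆ {x | ∀ i, x i ∈ Ioo (-1 / 2 : ℝ) (1 / 2)}
  integral_eq_one : ∫ x, toFun x = 1

/-- The representative in `[-1/2, 1/2)²` of a point of the torus. -/
def rep (z : Torus) : Fin 2 → ℝ :=
  fun i => (AddCircle.equivIco (1 : ℝ) (-1 / 2) (z i) : ℝ)

lemma measurable_rep : Measurable rep := by
  refine measurable_pi_lambda _ fun i => ?_
  exact measurable_subtype_coe.comp
    ((AddCircle.measurableEquivIco (1 : ℝ) (-1 / 2)).measurable.comp (measurable_pi_apply i))

/-- `ρ^ε(x) = ε⁻² ρ(ε⁻¹ x)`, extended periodically, as a function on the torus. For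
`0 < ε < 1` the support of `ρ^ε` lies in `(-1/2, 1/2)²`, so the periodic extension is the
value at the representative in `[-1/2, 1/2)²`. -/
def mollTorus (ρ : Mollifier) (ε : ℝ) (z : Torus) : ℝ :=
  (ε ^ 2)⁻¹ * ρ.toFun (ε⁻¹ • rep z)

lemma measurable_mollTorus (ρ : Mollifier) (ε : ℝ) : Measurable (mollTorus ρ ε) :=
  (ρ.smooth.continuous.measurable.comp (measurable_rep.const_smul ε⁻¹)).const_mul _

lemma mollTorus_bounded (ρ : Mollifier) (ε : ℝ) : ∃ M, ∀ z, ‖mollTorus ρ ε z‖ ≤ M := by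
  have hc : HasCompactSupport ρ.toFun := by
    refine IsCompact.of_isClosed_subset
      (isCompact_univ_pi fun _ : Fin 2 => isCompact_Icc (a := (-1 / 2 : ℝ)) (b := 1 / 2))
      (isClosed_tsupport _) fun x hx i _ => Ioo_subset_Icc_self (ρ.support_subset hx i)
  obtain ⟨M, hM⟩ := hc.exists_bound_of_continuous ρ.smooth.continuous
  refine ⟨‖(ε ^ 2)⁻¹‖ * M, fun z => ?_⟩
  rw [mollTorus, norm_mul]
  exact mul_le_mul_of_nonneg_left (hM _) (norm_nonneg _)

/-- The torus convolution `R^ε = ρ^ε * ρ^ε`. -/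
def R (ρ : Mollifier) (ε : ℝ) (z : Torus) : ℝ :=
  ∫ y : Torus, mollTorus ρ ε y * mollTorus ρ ε (z - y)

/-- Continuous paths `[0,t] → 𝕋²`, with the Borel σ-algebra of uniform convergence. -/
abbrev Path (t : ℝ≥0) : Type := C(Icc (0 : ℝ) t, Torus)

instance (t : ℝ≥0) : MeasurableSpace (Path t) := borel _

instance (t : ℝ≥0) : BorelSpace (Path t) := ⟨rfl⟩

/-- Lebesgue measure on the time interval `[0,t]`. -/
def timeMeasure (t : ℝ≥0) : Measure (Icc (0 : ℝ) t) := volume.comap Subtype.val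

instance (t : ℝ≥0) : IsFiniteMeasure (timeMeasure t) := by
  refine ⟨?_⟩
  rw [timeMeasure, comap_subtype_coe_apply measurableSet_Icc]
  exact (measure_mono (Subtype.coe_image_subset _ _)).trans_lt measure_Icc_lt_top

/-- The intersection time `𝓘_t^ε[X, Y] = ∫₀ᵗ R^ε(X(s) - Y(s)) ds`. -/
def intersectionTime (ρ : Mollifier) (ε : ℝ) {t : ℝ≥0} (X Y : Path t) : ℝ :=
  ∫ s, R ρ ε (X s - Y s) ∂(timeMeasure t)

/-- The law at time `v` of standard Brownian motion on the torus started at the origin: the image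
in the torus of the centered Gaussian law on `ℝ²` with covariance `v • 1`. -/
def heatLaw (v : ℝ≥0) : Measure Torus :=
  (Measure.pi fun _ : Fin 2 => gaussianReal 0 v).map fun y i => (y i : UnitAddCircle)

/-- `P` is the law on path space of standard Brownian motion on the torus running backwards in
time from the position `x` at time `t`. -/
structure IsBackwardBrownianLaw (t : ℝ≥0) (x : Torus) (P : Measure (Path t)) : Prop where
  isProbabilityMeasure : IsProbabilityMeasure P
  start : ∀ᵐ X ∂P, X ⟨t, t.2, le_rfl⟩ = x
  indep : HasIndepIncrements (fun (s : Icc (0 : ℝ) t) (X : Path t) => X s) P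
  law : ∀ s u : Icc (0 : ℝ) t, s ≤ u →
    P.map (fun X => X s - X u) = heatLaw (Real.toNNReal ((u : ℝ) - s))

/-- The Hilbert space `L²([0,t] × 𝕋²)` of integrands. -/
abbrev NoiseSpace (t : ℝ≥0) : Type :=
  Lp ℝ 2 ((timeMeasure t).prod (volume : Measure Torus))

instance (t : ℝ≥0) : MeasurableSpace (NoiseSpace t) := borel _

instance (t : ℝ≥0) : BorelSpace (NoiseSpace t) := ⟨rfl⟩

/-- `W` is a standard space-time white noise on `[0,t] × 𝕋²`, given through its Wiener integrals
`W f = ∫₀ᵗ ∫ f(s,y) W(dy ds)`: a centered Gaussian family indexed by `L²([0,t] × 𝕋²)` whose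
covariance is the inner product. As usual, the family is taken in a jointly measurable
version, so that integrals over random integrands make sense. -/
structure IsWhiteNoise {Ω : Type*} [MeasurableSpace Ω] (μ : Measure Ω) {t : ℝ≥0}
    (W : NoiseSpace t → Ω → ℝ) : Prop where
  measurable : Measurable (Function.uncurry W)
  gaussian : IsGaussianProcess W μ
  mean : ∀ f, ∫ ω, W f ω ∂μ = 0
  covariance : ∀ f g, ∫ ω, W f ω * W g ω ∂μ = inner ℝ f g

lemma memLp_integrand (ρ : Mollifier) (ε : ℝ) {t : ℝ≥0} (X : Path t) :
    MemLp (fun p : Icc (0 : ℝ) t × Torus => mollTorus ρ ε (X p.1 - p.2)) 2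
      ((timeMeasure t).prod volume) := by
  obtain ⟨M, hM⟩ := mollTorus_bounded ρ ε
  refine MemLp.of_bound ?_ M (Filter.Eventually.of_forall fun p => hM _)
  refine ((measurable_mollTorus ρ ε).comp ?_).aestronglyMeasurable
  exact (X.continuous.measurable.comp measurable_fst).sub measurable_snd

/-- The integrand `(s, y) ↦ ρ^ε(X(s) - y)`, as an element of `L²([0,t] × 𝕋²)`. -/
def integrand (ρ : Mollifier) (ε : ℝ) {t : ℝ≥0} (X : Path t) : NoiseSpace t :=
  (memLp_integrand ρ ε X).toLp _

section Tilted

variable {Ω : Type*} [MeasurableSpace Ω] (μ : Measure Ω) {t : ℝ≥0} (W : NoiseSpace t → Ω → ℝ)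
  (ρ : Mollifier) (ε : ℝ)

/-- `θ^{1/2} |log ε|^{-1/2} ∫₀ᵗ ∫ ρ^ε(X(s) - y) W(dy ds)`. -/
def energy (θ : ℝ) (ω : Ω) (X : Path t) : ℝ :=
  Real.sqrt θ / Real.sqrt |Real.log ε| * W (integrand ρ ε X) ω

/-- The renormalization constant `κ_θ^ε(t) = 𝐄 h̃_θ^ε(t, x)`, where
`h̃_θ^ε(t, x) = |log ε|^{1/2} log 𝔼_{X^{t,x}} exp(energy)` and `P` is the law of `X^{t,x}`. -/
def kappa (P : Measure (Path t)) (θ : ℝ) : ℝ :=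
  ∫ ω, Real.sqrt |Real.log ε| * Real.log (∫ X, Real.exp (energy W ρ ε θ ω X) ∂P) ∂μ

/-- The tilted path measure, whose density with respect to `P` is `𝓔 / ∫ 𝓔 dP` with
`𝓔 = exp(energy - |log ε|^{-1/2} κ)`. -/
def tiltedLaw (P : Measure (Path t)) (θ : ℝ) (ω : Ω) : Measure (Path t) :=
  P.tilted fun X => energy W ρ ε θ ω X - (Real.sqrt |Real.log ε|)⁻¹ * kappa μ W ρ ε P θ

/-- `F_{α,j;β,k;r,Q}(θ)`: the expectation over the noise of the expectation of
`Q[X₀] 𝓘_t^ε[X_{α;j}, X_{β;k}]^r`, where the paths `X_{γ;l}` (`γ = 0, 1, 2`, `l = 1, …, J`) are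
independent with laws the tilted versions of `P l`. -/
def Fterm {J : ℕ} (P : Fin J → Measure (Path t)) (a b : Fin 3 × Fin J) (r : ℝ)
    (Q : (Fin J → Path t) → ℝ) (θ : ℝ) : ℝ :=
  ∫ ω, (∫ X : Fin 3 × Fin J → Path t,
      Q (fun j => X (0, j)) * intersectionTime ρ ε (X a) (X b) ^ r
    ∂(Measure.pi fun i : Fin 3 × Fin J => tiltedLaw μ W ρ ε (P i.2) θ ω)) ∂μ

/-- `F_{r,Q}(θ)`, the sum of the `F_{α,j;β,k;r,Q}(θ)` over `(α,j) ≠ (β,k)`. -/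
def F {J : ℕ} (P : Fin J → Measure (Path t)) (r : ℝ) (Q : (Fin J → Path t) → ℝ) (θ : ℝ) : ℝ :=
  ∑ α : Fin 3, ∑ β : Fin 3, ∑ j : Fin J, ∑ k : Fin J,
    if (α, j) ≠ (β, k) then Fterm μ W ρ ε P (α, j) (β, k) r Q θ else 0

/-- `G_{r,Q}(θ) = |log ε|^{-r} F_{r,Q}(θ)`. -/
def G {J : ℕ} (P : Fin J → Measure (Path t)) (r : ℝ) (Q : (Fin J → Path t) → ℝ) (θ : ℝ) : ℝ :=
  |Real.log ε| ^ (-r) * F μ W ρ ε P r Q θ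

end Tilted

end KPZ

end

/-! For a path `X` put `U X = W (integrand ρ ε X)`. The family `U` is a centred Gaussian field on
path space whose covariance `K` is the intersection time, by evenness of the mollifier, and whose
variance is a constant `v`, because `K X X` involves only `R` at the origin. The tilted law is the
Gibbs measure with energy `β U`, where `β = √θ / √|log ε|`; the constant `κ` cancels in the
normalization. Write `tiltedMean` for the annealed mean under a product of such measures.

Differentiating in `β` multiplies the Gibbs weight by `∑ i, (U (X i) - ⟨U⟩)`, and the average `⟨U⟩`
is realized by a fresh independent replica, a fourth layer of paths. Gaussian integration by parts
(`integral_mul_weight`) then trades each factor `U (X j)` for `β ∑ k, (K (X j) (X k) - ⟨K (X j)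
·⟩)`, and a fifth layer absorbs the new averages. The derivative is thus `β` times a signed sum of
means of the observable times `K (X c) (X d)` over five layers (`hasDerivAt_tiltedMean_layers`). The
explicit factor `β` compensates the singularity of `√θ`, so the derivative in `θ` exists up to `θ =
0`.

The diagonal terms all carry the constant `v` and cancel in pairs. Off the diagonal, `x ^ r * y ≤ x
^ (r + 1) + y ^ (r + 1)` leaves a single power of a single intersection time, which involves at most
two layers besides layer `0`. Since the replicas are exchangeable these can be renamed to layers `1`
and `2`, so three layers suffice to close the estimate (`abs_pairGradient_le`). This is claim 1.

For bounded `Q`, claim 1 applied to `|Q|` at every exponent is a hierarchy of differential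
inequalities. Iterating it `n` times gives the Taylor sum plus a remainder of order `(Cθ) ^ n / n!`
times an `n`-th power, because `K ≤ v`; the remainder tends to zero (`hierarchy_tsum`).

The analytic work lies in two places: dominating Gibbs weights, including their random denominators,
when the observable is merely integrable; and integrating by parts although the denominator depends
on the whole field. -/

noncomputable section

namespace KPZ

/-! ### Gibbs densities: derivatives and exponential-moment bounds -/

section Gibbs

variable {S ι : Type*} [MeasurableSpace S] [Fintype ι]

/-- The Gibbs density with respect to `P` of the exponential weight `exp e`. -/
def gibbs (P : Measure S) (e : S → ℝ) (x : S) : ℝ :=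
  Real.exp (e x) / ∫ y, Real.exp (e y) ∂P

/-- The average of `h` under the Gibbs measure. -/
def gibbsAvg (P : Measure S) (e h : S → ℝ) : ℝ := ∫ y, h y * gibbs P e y ∂P

/-- The density of a product of Gibbs measures. -/
def gibbsWeight (P : ι → Measure S) (e : S → ℝ) (X : ι → S) : ℝ := ∏ i, gibbs (P i) e (X i)

/-- The exponential moment of `|u|` of order `c`. -/
def expMoment (P : Measure S) (u : S → ℝ) (c : ℝ) : ℝ := ∫ y, Real.exp (c * |u y|) ∂P

/-- A function of `X` that dominates the Gibbs weights of small multiples of `u`. -/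
def dominant (P : ι → Measure S) (u : S → ℝ) (C : ℝ) (X : ι → S) : ℝ :=
  1 + ∑ i, (Real.exp (C * |u (X i)|) + expMoment (P i) u C)

lemma gibbs_nonneg (P : Measure S) (e : S → ℝ) (x : S) : 0 ≤ gibbs P e x :=
  div_nonneg (Real.exp_pos _).le (integral_nonneg fun _ => (Real.exp_pos _).le)

lemma gibbsWeight_nonneg (P : ι → Measure S) (e : S → ℝ) (X : ι → S) : 0 ≤ gibbsWeight P e X :=
  Finset.prod_nonneg fun _ _ => gibbs_nonneg _ _ _

lemma exp_mul_abs_le (a t s b : ℝ) :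
    Real.exp (a + t * b + s * |b|) ≤
      Real.exp (a + (t + s) * b) + Real.exp (a + (t - s) * b) := by
  rcases abs_cases b with ⟨h, -⟩ | ⟨h, -⟩
  · rw [h]
    have : a + t * b + s * b = a + (t + s) * b := by ring
    rw [this]
    linarith [Real.exp_pos (a + (t - s) * b)]
  · rw [h]
    have : a + t * b + s * -b = a + (t - s) * b := by ring
    rw [this]
    linarith [Real.exp_pos (a + (t + s) * b)]

lemma hasDerivAt_integral_exp {P : Measure S} {a b : S → ℝ} (hb : Measurable b)
    (hInt : ∀ t : ℝ, Integrable (fun y => Real.exp (a y + t * b y)) P) (t : ℝ) :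
    HasDerivAt (fun t => ∫ y, Real.exp (a y + t * b y) ∂P)
      (∫ y, b y * Real.exp (a y + t * b y) ∂P) t := by
  -- On the unit ball around `t` the integrand costs one factor `exp |b|`, and the prefactor `|b|`
  -- costs another; hence the shift by `2` in the bound.
  refine (hasDerivAt_integral_of_dominated_loc_of_deriv_le
    (bound := fun y => Real.exp (a y + (t + 2) * b y) + Real.exp (a y + (t - 2) * b y))
    (F' := fun t y => b y * Real.exp (a y + t * b y))
    (Metric.ball_mem_nhds t one_pos) (.of_forall fun s => (hInt s).1) (hInt t)
    (hb.aestronglyMeasurable.mul (hInt t).1) (.of_forall fun y s hs => ?_)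
    ((hInt _).add (hInt _)) (.of_forall fun y s _ => ?_)).2
  · refine le_trans ?_ (exp_mul_abs_le (a y) t 2 (b y))
    have h1 : ‖b y‖ ≤ Real.exp |b y| := by
      rw [Real.norm_eq_abs]; linarith [Real.add_one_le_exp |b y|]
    have h2 : Real.exp (a y + s * b y) ≤ Real.exp (a y + t * b y + |b y|) := by
      refine Real.exp_le_exp.2 ?_
      have h3 : |s - t| ≤ 1 := by
        rw [Metric.mem_ball, Real.dist_eq] at hs; exact hs.le
      have h4 : (s - t) * b y ≤ |b y| := by
        refine (le_abs_self _).trans ?_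
        rw [abs_mul]
        exact mul_le_of_le_one_left (abs_nonneg _) h3
      nlinarith
    rw [norm_mul, Real.norm_of_nonneg (Real.exp_pos _).le]
    refine (mul_le_mul h1 h2 (Real.exp_pos _).le (Real.exp_pos _).le).trans ?_
    rw [← Real.exp_add]
    exact Real.exp_le_exp.2 (by linarith)
  · have : HasDerivAt (fun s => a y + s * b y) (b y) s := by
      simpa using ((hasDerivAt_id s).mul_const (b y)).const_add (a y)
    simpa [mul_comm] using this.exp

/-- Quotient rule: the numerator contributes `b x`, the partition function its Gibbs average. The
general form `a + t b` serves twice, for differentiation in the inverse temperature and for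
differentiation in one Gaussian coordinate of the field. -/
lemma hasDerivAt_gibbs {P : Measure S} [IsProbabilityMeasure P] {a b : S → ℝ} (hb : Measurable b)
    (hInt : ∀ t : ℝ, Integrable (fun y => Real.exp (a y + t * b y)) P) (x : S) (t : ℝ) :
    HasDerivAt (fun t => gibbs P (fun y => a y + t * b y) x)
      (gibbs P (fun y => a y + t * b y) x *
        (b x - gibbsAvg P (fun y => a y + t * b y) b)) t := by
  have hZ := integral_exp_pos (hInt t)
  have h1 : HasDerivAt (fun s => Real.exp (a x + s * b x)) (Real.exp (a x + t * b x) * b x) t := by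
    have : HasDerivAt (fun s => a x + s * b x) (b x) t := by
      simpa using ((hasDerivAt_id t).mul_const (b x)).const_add (a x)
    exact this.exp
  have h2 := h1.div (hasDerivAt_integral_exp hb hInt t) hZ.ne'
  refine h2.congr_deriv ?_
  have h3 : gibbsAvg P (fun y => a y + t * b y) b =
      (∫ y, b y * Real.exp (a y + t * b y) ∂P) / ∫ y, Real.exp (a y + t * b y) ∂P := by
    rw [gibbsAvg, ← integral_div]
    simp only [gibbs, mul_div_assoc]
  rw [h3, gibbs]
  field_simp

lemma hasDerivAt_gibbsWeight {P : ι → Measure S} [∀ i, IsProbabilityMeasure (P i)] {a b : S → ℝ}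
    (hb : Measurable b)
    (hInt : ∀ i, ∀ t : ℝ, Integrable (fun y => Real.exp (a y + t * b y)) (P i)) (X : ι → S)
    (t : ℝ) :
    HasDerivAt (fun t => gibbsWeight P (fun y => a y + t * b y) X)
      (gibbsWeight P (fun y => a y + t * b y) X *
        ∑ i, (b (X i) - gibbsAvg (P i) (fun y => a y + t * b y) b)) t := by
  classical
  have h := HasDerivAt.fun_finsetProd (u := Finset.univ)
    fun (i : ι) _ => hasDerivAt_gibbs hb (hInt i) (X i) t
  refine h.congr_deriv ?_
  rw [Finset.mul_sum]
  refine Finset.sum_congr rfl fun i _ => ?_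
  rw [gibbsWeight, ← Finset.mul_prod_erase _ _ (Finset.mem_univ i), smul_eq_mul]
  ring

section Bounds

variable {P : Measure S} {u : S → ℝ}

lemma integrable_exp_mul (hu : Measurable u)
    (hE : ∀ c : ℝ, Integrable (fun y => Real.exp (c * |u y|)) P) (β : ℝ) :
    Integrable (fun y => Real.exp (β * u y)) P := by
  refine (hE |β|).mono (hu.const_mul β).exp.aestronglyMeasurable (.of_forall fun y => ?_)
  rw [Real.norm_of_nonneg (Real.exp_pos _).le, Real.norm_of_nonneg (Real.exp_pos _).le, ← abs_mul]
  exact Real.exp_le_exp.2 (le_abs_self _)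

lemma exp_mul_le_exp_mul_abs {β c : ℝ} (hβ : |β| ≤ c) (x : ℝ) :
    Real.exp (β * x) ≤ Real.exp (c * |x|) := by
  refine Real.exp_le_exp.2 ((le_abs_self _).trans ?_)
  rw [abs_mul]
  exact mul_le_mul_of_nonneg_right hβ (abs_nonneg _)

/-- Jensen's inequality for the inverse: `1 / Z` is at most the mean of `exp (-β u)`. This controls
the random denominator by an exponential moment, which is linear in the measure. -/
lemma inv_integral_exp_le [IsProbabilityMeasure P] (hu : Measurable u)
    (hE : ∀ c : ℝ, Integrable (fun y => Real.exp (c * |u y|)) P) {β c : ℝ} (hβ : |β| ≤ c) :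
    (∫ y, Real.exp (β * u y) ∂P)⁻¹ ≤ expMoment P u c := by
  have hi := integrable_exp_mul hu hE β
  have hZ := integral_exp_pos hi
  set Z := ∫ y, Real.exp (β * u y) ∂P with hZdef
  -- The integrand is the tangent line to `s ↦ 1 / s` at `Z`, evaluated at `exp (β u)`; convexity
  -- puts it below `exp (-β u)`.
  have h1 : ∫ y, (2 * Z⁻¹ - Real.exp (β * u y) * (Z⁻¹ * Z⁻¹)) ∂P = Z⁻¹ := by
    rw [integral_sub (integrable_const _) (hi.mul_const _), integral_const, integral_mul_const,
      ← hZdef]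
    simp
    field_simp
    norm_num
  rw [← h1]
  refine integral_mono ((integrable_const _).sub (hi.mul_const _)) (hE c) fun y => ?_
  have h2 : Real.exp (-β * u y) ≤ Real.exp (c * |u y|) :=
    exp_mul_le_exp_mul_abs (by rwa [abs_neg]) _
  refine le_trans ?_ h2
  rw [neg_mul, Real.exp_neg]
  have he := Real.exp_pos (β * u y)
  have h3 : 0 ≤ (Real.exp (β * u y))⁻¹ * (1 - Real.exp (β * u y) * Z⁻¹) ^ 2 := by positivity
  have h4 : (Real.exp (β * u y))⁻¹ * (1 - Real.exp (β * u y) * Z⁻¹) ^ 2 =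
      (Real.exp (β * u y))⁻¹ - (2 * Z⁻¹ - Real.exp (β * u y) * (Z⁻¹ * Z⁻¹)) := by
    field_simp
    ring
  simp only
  linarith

lemma one_le_expMoment [IsProbabilityMeasure P]
    (hE : ∀ c : ℝ, Integrable (fun y => Real.exp (c * |u y|)) P) {c : ℝ}
    (hc : 0 ≤ c) : 1 ≤ expMoment P u c := by
  have h : ∫ _, (1 : ℝ) ∂P = 1 := by simp
  rw [← h]
  exact integral_mono (integrable_const _) (hE c) fun y => Real.one_le_exp (by positivity)

lemma expMoment_mono (hE : ∀ c : ℝ, Integrable (fun y => Real.exp (c * |u y|)) P) {c d : ℝ}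
    (hcd : c ≤ d) : expMoment P u c ≤ expMoment P u d :=
  integral_mono (hE c) (hE d) fun _ =>
    Real.exp_le_exp.2 (mul_le_mul_of_nonneg_right hcd (abs_nonneg _))

lemma expMoment_pow_le [IsProbabilityMeasure P]
    (hE : ∀ c : ℝ, Integrable (fun y => Real.exp (c * |u y|)) P) (c : ℝ)
    (p : ℕ) : expMoment P u c ^ p ≤ expMoment P u (p * c) := by
  have hp : ∀ y, Real.exp (c * |u y|) ^ p = Real.exp (p * c * |u y|) := fun y => by
    rw [← Real.exp_nat_mul, mul_assoc]
  have h := (convexOn_pow p).map_integral_le (μ := P) (f := fun y => Real.exp (c * |u y|))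
    (continuous_pow p).continuousOn isClosed_Ici (.of_forall fun y => (Real.exp_pos _).le) (hE c)
    (by simpa only [Function.comp_def, hp] using hE (p * c))
  simpa only [hp, expMoment] using h

lemma gibbs_le [IsProbabilityMeasure P] (hu : Measurable u)
    (hE : ∀ c : ℝ, Integrable (fun y => Real.exp (c * |u y|)) P) {β c : ℝ} (hβ : |β| ≤ c)
    (x : S) : gibbs P (fun y => β * u y) x ≤ Real.exp (c * |u x|) * expMoment P u c := by
  rw [gibbs, div_eq_mul_inv]
  exact mul_le_mul (exp_mul_le_exp_mul_abs hβ _) (inv_integral_exp_le hu hE hβ)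
    (inv_nonneg.2 (integral_nonneg fun _ => (Real.exp_pos _).le)) (Real.exp_pos _).le

lemma abs_mul_gibbs_le [IsProbabilityMeasure P] (hu : Measurable u)
    (hE : ∀ c : ℝ, Integrable (fun y => Real.exp (c * |u y|)) P) {β c : ℝ} (hβ : |β| ≤ c)
    (x : S) : |u x| * gibbs P (fun y => β * u y) x ≤
      Real.exp ((c + 1) * |u x|) * expMoment P u c := by
  have h1 : |u x| ≤ Real.exp |u x| := by linarith [Real.add_one_le_exp |u x|]
  refine (mul_le_mul h1 (gibbs_le hu hE hβ x) (gibbs_nonneg _ _ _) (Real.exp_pos _).le).trans ?_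
  rw [← mul_assoc, ← Real.exp_add]
  refine le_of_eq ?_
  ring_nf

lemma measurable_gibbs {e : S → ℝ} (he : Measurable e) : Measurable (gibbs P e) :=
  he.exp.div_const _

lemma gibbsAvg_abs_le [IsProbabilityMeasure P] (hu : Measurable u)
    (hE : ∀ c : ℝ, Integrable (fun y => Real.exp (c * |u y|)) P) {β c : ℝ} (hβ : |β| ≤ c) :
    gibbsAvg P (fun y => β * u y) (fun y => |u y|) ≤
      expMoment P u (c + 1) * expMoment P u c := by
  rw [gibbsAvg, expMoment, ← integral_mul_const]
  exact integral_mono_of_nonneg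
    (.of_forall fun y => mul_nonneg (abs_nonneg _) (gibbs_nonneg _ _ _))
    ((hE _).mul_const _) (.of_forall fun y => abs_mul_gibbs_le hu hE hβ y)

lemma abs_gibbsAvg_le (P : Measure S) (e u : S → ℝ) :
    |gibbsAvg P e u| ≤ gibbsAvg P e fun y => |u y| := by
  refine (abs_integral_le_integral_abs).trans (le_of_eq ?_)
  simp only [gibbsAvg, abs_mul, abs_of_nonneg (gibbs_nonneg _ _ _)]

end Bounds

/-- Every factor is at most the largest one; the `1` covers an empty index set. Turning the product
into a sum leaves terms that see one point each, so that only one-point exponential moments of the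
field are needed later. -/
lemma prod_le_one_add_sum_pow {g : ι → ℝ} (hg : ∀ i, 0 ≤ g i) :
    ∏ i, g i ≤ 1 + ∑ i, g i ^ Fintype.card ι := by
  rcases isEmpty_or_nonempty ι with h | h
  · simp
  obtain ⟨j, hj⟩ := Finite.exists_max g
  have h1 : ∏ i, g i ≤ g j ^ Fintype.card ι :=
    (Finset.prod_le_prod (fun i _ => hg i) fun i _ => hj i).trans_eq (by simp)
  have h2 : g j ^ Fintype.card ι ≤ ∑ i, g i ^ Fintype.card ι :=
    Finset.single_le_sum (f := fun i => g i ^ Fintype.card ι) (fun i _ => pow_nonneg (hg i) _)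
      (Finset.mem_univ j)
  linarith

section Dominant

variable {P : ι → Measure S} [∀ i, IsProbabilityMeasure (P i)] {u : S → ℝ}

/-- The cube leaves room for one moment from the partition function of the density and two from the
bound on a Gibbs average of `|u|`. With `n` indices, splitting `a b ≤ a² + b²` doubles the powers,
so the moment appears to the power `6 n`, which Jensen moves into the exponent. -/
lemma prod_exp_mul_expMoment_le
    (hE : ∀ i, ∀ c : ℝ, Integrable (fun y => Real.exp (c * |u y|)) (P i)) {c : ℝ} (hc : 0 ≤ c)
    (X : ι → S) :
    ∏ i, (Real.exp (c * |u (X i)|) * expMoment (P i) u c ^ 3) ≤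
      dominant P u (6 * Fintype.card ι * c) X := by
  set n := Fintype.card ι with hn
  have hN : ∀ i, 0 ≤ expMoment (P i) u c := fun i => zero_le_one.trans (one_le_expMoment (hE i) hc)
  refine (prod_le_one_add_sum_pow fun i =>
    mul_nonneg (Real.exp_pos _).le (pow_nonneg (hN i) 3)).trans ?_
  rw [dominant]
  refine add_le_add le_rfl (Finset.sum_le_sum fun i _ => ?_)
  rw [← hn, mul_pow]
  have h1 : Real.exp (c * |u (X i)|) ^ n * (expMoment (P i) u c ^ 3) ^ n ≤
      (Real.exp (c * |u (X i)|) ^ n) ^ 2 + ((expMoment (P i) u c ^ 3) ^ n) ^ 2 := by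
    nlinarith [sq_nonneg (Real.exp (c * |u (X i)|) ^ n - (expMoment (P i) u c ^ 3) ^ n),
      sq_nonneg (Real.exp (c * |u (X i)|) ^ n), sq_nonneg ((expMoment (P i) u c ^ 3) ^ n)]
  refine h1.trans (add_le_add ?_ ?_)
  · rw [← pow_mul, ← Real.exp_nat_mul]
    refine Real.exp_le_exp.2 ?_
    push_cast
    have : 0 ≤ n * (c * |u (X i)|) := by positivity
    nlinarith
  · rw [← pow_mul, ← pow_mul]
    refine (expMoment_pow_le (hE i) c _).trans (le_of_eq ?_)
    push_cast
    ring_nf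

lemma gibbsWeight_le_dominant (hu : Measurable u)
    (hE : ∀ i, ∀ c : ℝ, Integrable (fun y => Real.exp (c * |u y|)) (P i)) {β c : ℝ}
    (hβ : |β| ≤ c) (X : ι → S) :
    gibbsWeight P (fun y => β * u y) X ≤ dominant P u (6 * Fintype.card ι * (c + 1)) X := by
  have hc : 0 ≤ c := (abs_nonneg _).trans hβ
  refine le_trans ?_ (prod_exp_mul_expMoment_le hE (by linarith) X)
  refine Finset.prod_le_prod (fun i _ => gibbs_nonneg _ _ _) fun i _ => ?_
  have h1 := one_le_expMoment (hE i) (c := c + 1) (by linarith)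
  refine (gibbs_le hu (hE i) (c := c + 1) (by linarith) _).trans
    (mul_le_mul_of_nonneg_left (le_self_pow₀ h1 (by norm_num)) (Real.exp_pos _).le)

lemma gibbsWeight_mul_le_dominant (hu : Measurable u)
    (hE : ∀ i, ∀ c : ℝ, Integrable (fun y => Real.exp (c * |u y|)) (P i)) {β c : ℝ}
    (hβ : |β| ≤ c) (X : ι → S) (j : ι) :
    gibbsWeight P (fun y => β * u y) X *
        (|u (X j)| + gibbsAvg (P j) (fun y => β * u y) (fun y => |u y|)) ≤
      2 * dominant P u (6 * Fintype.card ι * (c + 1)) X := by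
  classical
  have hc : 0 ≤ c := (abs_nonneg _).trans hβ
  refine le_trans ?_ (mul_le_mul_of_nonneg_left
    (prod_exp_mul_expMoment_le hE (c := c + 1) (by linarith) X) two_pos.le)
  have hN : ∀ i, 1 ≤ expMoment (P i) u (c + 1) := fun i => one_le_expMoment (hE i) (by linarith)
  have hg : ∀ i, gibbs (P i) (fun y => β * u y) (X i) ≤
      Real.exp ((c + 1) * |u (X i)|) * expMoment (P i) u (c + 1) ^ 3 := fun i =>
    (gibbs_le hu (hE i) (c := c + 1) (by linarith) _).trans
      (mul_le_mul_of_nonneg_left (le_self_pow₀ (hN i) (by norm_num)) (Real.exp_pos _).le)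
  rw [gibbsWeight, ← Finset.mul_prod_erase _ _ (Finset.mem_univ j),
    ← Finset.mul_prod_erase _ (fun i => Real.exp ((c + 1) * |u (X i)|) * _) (Finset.mem_univ j),
    mul_right_comm, ← mul_assoc]
  refine mul_le_mul ?_ (Finset.prod_le_prod (fun i _ => gibbs_nonneg _ _ _) fun i _ => hg i)
    (Finset.prod_nonneg fun i _ => gibbs_nonneg _ _ _) ?_
  swap
  · have := hN j
    positivity
  set E := Real.exp ((c + 1) * |u (X j)|) with hEdef
  set N := expMoment (P j) u (c + 1) with hNdef
  have hN1 : 1 ≤ N := hN j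
  have hEp : 0 < E := Real.exp_pos _
  have hcN : expMoment (P j) u c ≤ N := expMoment_mono (hE j) (by linarith)
  have hc1 : 1 ≤ expMoment (P j) u c := one_le_expMoment (hE j) hc
  have h1 : |u (X j)| * gibbs (P j) (fun y => β * u y) (X j) ≤ E * N ^ 3 :=
    (abs_mul_gibbs_le hu (hE j) hβ (X j)).trans
      (mul_le_mul_of_nonneg_left (hcN.trans (le_self_pow₀ hN1 (by norm_num))) hEp.le)
  have h2 : gibbsAvg (P j) (fun y => β * u y) (fun y => |u y|) ≤ N ^ 2 := by
    refine (gibbsAvg_abs_le hu (hE j) hβ).trans ?_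
    rw [sq]
    exact mul_le_mul_of_nonneg_left hcN (by linarith)
  have h3 : gibbs (P j) (fun y => β * u y) (X j) ≤ E * N :=
    gibbs_le hu (hE j) (c := c + 1) (by linarith) _
  have h4 : gibbs (P j) (fun y => β * u y) (X j) *
      gibbsAvg (P j) (fun y => β * u y) (fun y => |u y|) ≤ E * N * N ^ 2 :=
    (mul_le_mul_of_nonneg_left h2 (gibbs_nonneg _ _ _)).trans
      (mul_le_mul_of_nonneg_right h3 (by positivity))
  nlinarith

/-- A bound uniform over `|β| ≤ c`, as required for differentiating under the annealed integral. -/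
lemma abs_weight_mul_sum_le {u : S → ℝ} (hu : Measurable u)
    (hE : ∀ i, ∀ c : ℝ, Integrable (fun y => Real.exp (c * |u y|)) (P i)) {β c : ℝ}
    (hβ : |β| ≤ c) (X : ι → S) :
    |gibbsWeight P (fun y => β * u y) X *
        ∑ i, (u (X i) - gibbsAvg (P i) (fun y => β * u y) u)| ≤
      dominant P u (6 * Fintype.card ι * (c + 1)) X * (2 * Fintype.card ι) := by
  rw [abs_mul, abs_of_nonneg (gibbsWeight_nonneg _ _ _)]
  refine (mul_le_mul_of_nonneg_left (Finset.abs_sum_le_sum_abs _ _)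
    (gibbsWeight_nonneg _ _ _)).trans ?_
  rw [Finset.mul_sum]
  refine (Finset.sum_le_sum fun i _ => ?_).trans (le_of_eq (a := ∑ _i : ι,
    2 * dominant P u (6 * Fintype.card ι * (c + 1)) X) ?_)
  · refine le_trans (mul_le_mul_of_nonneg_left ?_ (gibbsWeight_nonneg _ _ _))
      (gibbsWeight_mul_le_dominant hu hE hβ X i)
    exact (abs_sub _ _).trans (add_le_add le_rfl (abs_gibbsAvg_le _ _ _))
  · rw [Finset.sum_const, Finset.card_univ, nsmul_eq_mul]
    ring

end Dominant

end Gibbs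

/-! ### Joint measurability of Gibbs weights and averages -/

section Measurability

variable {S T ι : Type*} [MeasurableSpace S] [MeasurableSpace T] [Fintype ι]

lemma measurable_integral_exp {P : Measure S} [SFinite P] {e : T → S → ℝ}
    (he : Measurable fun p : T × S => e p.1 p.2) :
    Measurable fun t => ∫ y, Real.exp (e t y) ∂P :=
  (he.exp.stronglyMeasurable.integral_prod_right (ν := P)).measurable

lemma measurable_gibbs_comp {P : Measure S} [SFinite P] {e : T → S → ℝ}
    (he : Measurable fun p : T × S => e p.1 p.2) {x : T → S} (hx : Measurable x) :
    Measurable fun t => gibbs P (e t) (x t) :=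
  (he.comp (measurable_id.prodMk hx)).exp.div (measurable_integral_exp he)

lemma measurable_gibbsWeight {P : ι → Measure S} [∀ i, SFinite (P i)] {e : T → S → ℝ}
    (he : Measurable fun p : T × S => e p.1 p.2) {X : T → ι → S} (hX : Measurable X) :
    Measurable fun t => gibbsWeight P (e t) (X t) :=
  Finset.measurable_fun_prod _ fun i _ => measurable_gibbs_comp he (measurable_pi_iff.1 hX i)

lemma measurable_gibbsAvg {P : Measure S} [SFinite P] {e h : T → S → ℝ}
    (he : Measurable fun p : T × S => e p.1 p.2) (hh : Measurable fun p : T × S => h p.1 p.2) :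
    Measurable fun t => gibbsAvg P (e t) (h t) := by
  have h1 : Measurable fun p : T × S => h p.1 p.2 * gibbs P (e p.1) p.2 :=
    hh.mul (measurable_gibbs_comp (e := fun (p : T × S) y => e p.1 y)
      (he.comp ((measurable_fst.comp measurable_fst).prodMk measurable_snd)) measurable_snd)
  exact (h1.stronglyMeasurable.integral_prod_right (ν := P)).measurable

end Measurability

/-! ### Gaussian fields and differentiation of annealed means -/

/-- `U` is a jointly measurable centred Gaussian field with continuous covariance `K`, of constant
variance `v`. -/
structure IsGaussianField {S Ω : Type*} [TopologicalSpace S] [MeasurableSpace S]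
    [MeasurableSpace Ω] (μ : Measure Ω) (U : S → Ω → ℝ) (K : S → S → ℝ) (v : ℝ≥0) : Prop where
  measurable : Measurable fun p : S × Ω => U p.1 p.2
  gaussian : IsGaussianProcess U μ
  mean : ∀ x, ∫ ω, U x ω ∂μ = 0
  covariance : ∀ x y, ∫ ω, U x ω * U y ω ∂μ = K x y
  diag : ∀ x, K x x = v
  continuous : Continuous fun p : S × S => K p.1 p.2

/-- The annealed mean of `B` under the product of the Gibbs measures with energy `β U`. -/
def tiltedMean {S Ω ι : Type*} [MeasurableSpace S] [MeasurableSpace Ω] [Fintype ι]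
    (μ : Measure Ω) (U : S → Ω → ℝ) (P : ι → Measure S) (β : ℝ) (B : (ι → S) → ℝ) : ℝ :=
  ∫ ω, ∫ X, B X * gibbsWeight P (fun y => β * U y ω) X ∂(Measure.pi P) ∂μ

namespace IsGaussianField

variable {S Ω ι : Type*} [TopologicalSpace S] [MeasurableSpace S] [MeasurableSpace Ω] [Fintype ι]
  {μ : Measure Ω} {U : S → Ω → ℝ} {K : S → S → ℝ} {v : ℝ≥0}

lemma measurable_apply (h : IsGaussianField μ U K v) (x : S) : Measurable (U x) :=
  h.measurable.comp measurable_prodMk_left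

lemma measurable_section (h : IsGaussianField μ U K v) (ω : Ω) : Measurable fun x => U x ω :=
  h.measurable.comp measurable_prodMk_right

lemma measurable_swap (h : IsGaussianField μ U K v) : Measurable fun p : Ω × S => U p.2 p.1 :=
  h.measurable.comp _root_.measurable_swap

lemma measurable_energy (h : IsGaussianField μ U K v) (β : ℝ) :
    Measurable fun p : Ω × S => β * U p.2 p.1 :=
  h.measurable_swap.const_mul β

lemma measurable_energy_fst (h : IsGaussianField μ U K v) {T : Type*} [MeasurableSpace T] (β : ℝ) :
    Measurable fun p : (Ω × T) × S => β * U p.2 p.1.1 :=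
  (h.measurable.comp (measurable_snd.prodMk (measurable_fst.comp measurable_fst))).const_mul β

lemma measurable_weight (h : IsGaussianField μ U K v) {P : ι → Measure S}
    [∀ i, SFinite (P i)] (β : ℝ) :
    Measurable fun p : Ω × (ι → S) => gibbsWeight P (fun y => β * U y p.1) p.2 :=
  measurable_gibbsWeight (e := fun (p : Ω × (ι → S)) y => β * U y p.1)
    (h.measurable_energy_fst β) measurable_snd

lemma memLp_two (h : IsGaussianField μ U K v) (x : S) : MemLp (U x) 2 μ :=
  (h.gaussian.hasGaussianLaw_eval x).memLp_two

lemma map_eq (h : IsGaussianField μ U K v) (x : S) : μ.map (U x) = gaussianReal 0 v := by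
  rw [(h.gaussian.hasGaussianLaw_eval x).map_eq_gaussianReal, h.mean,
    variance_of_integral_eq_zero (h.measurable_apply x).aemeasurable (h.mean x)]
  have : ∫ ω, U x ω ^ 2 ∂μ = v := by
    rw [← h.diag x, ← h.covariance]
    simp only [sq]
  rw [this, Real.toNNReal_coe]

lemma integral_comp (h : IsGaussianField μ U K v) (x : S) {f : ℝ → ℝ} (hf : Measurable f) :
    ∫ ω, f (U x ω) ∂μ = ∫ z, f z ∂(gaussianReal 0 v) := by
  rw [← h.map_eq x, integral_map (h.measurable_apply x).aemeasurable hf.aestronglyMeasurable]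

lemma integrable_exp_abs (h : IsGaussianField μ U K v) (x : S) (c : ℝ) :
    Integrable (fun ω => Real.exp (c * |U x ω|)) μ := by
  have h1 : ∀ d : ℝ, Integrable (fun z => Real.exp (d * z)) (gaussianReal 0 v) := fun d =>
    integrable_exp_mul_gaussianReal d
  have h2 : Integrable (fun z => Real.exp (c * |z|)) (gaussianReal 0 v) := by
    refine ((h1 c).add (h1 (-c))).mono'
      (measurable_id.abs.const_mul c).exp.aestronglyMeasurable (.of_forall fun z => ?_)
    rw [Real.norm_of_nonneg (Real.exp_pos _).le]
    simp only [Pi.add_apply]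
    rcases abs_cases z with ⟨hz, -⟩ | ⟨hz, -⟩
    · rw [hz]; linarith [Real.exp_pos (-c * z)]
    · rw [hz, mul_neg, ← neg_mul]; linarith [Real.exp_pos (c * z)]
  rw [← h.map_eq x] at h2
  exact h2.comp_measurable (h.measurable_apply x)

variable [IsProbabilityMeasure μ]

/-- Since the variance is constant, the `Ω`-integral of the exponential is the same number at every
point, and Tonelli reduces the claim to integrability of `B`. This is why an integrable, possibly
unbounded, observable is enough. -/
lemma integrable_mul_exp_abs (h : IsGaussianField μ U K v) {T : Type*} [MeasurableSpace T]
    {ν : Measure T} [SFinite ν] {x : T → S} (hx : Measurable x) {B : T → ℝ} (hB : Integrable B ν)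
    (c : ℝ) :
    Integrable (fun p : Ω × T => B p.2 * Real.exp (c * |U (x p.2) p.1|)) (μ.prod ν) := by
  have hm : Measurable fun p : Ω × T => Real.exp (c * |U (x p.2) p.1|) :=
    ((h.measurable.comp ((hx.comp measurable_snd).prodMk measurable_fst)).abs.const_mul c).exp
  have hm' : AEStronglyMeasurable (fun p : Ω × T => B p.2 * Real.exp (c * |U (x p.2) p.1|))
      (μ.prod ν) := hB.1.comp_snd.mul hm.aestronglyMeasurable
  refine (integrable_prod_iff' hm').2
    ⟨.of_forall fun y => (h.integrable_exp_abs (x y) c).const_mul (B y), ?_⟩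
  have : ∀ y, ∫ ω, ‖B y * Real.exp (c * |U (x y) ω|)‖ ∂μ =
      ‖B y‖ * ∫ z, Real.exp (c * |z|) ∂(gaussianReal 0 v) := fun y => by
    simp only [norm_mul, Real.norm_of_nonneg (Real.exp_pos _).le]
    rw [integral_const_mul,
      h.integral_comp (x y) (f := fun z => Real.exp (c * |z|))
        (measurable_id.abs.const_mul c).exp]
  simp only [this]
  exact hB.norm.mul_const _

lemma integrable_exp_abs_prod (h : IsGaussianField μ U K v) (P : Measure S)
    [IsProbabilityMeasure P] (c : ℝ) :
    Integrable (fun p : Ω × S => Real.exp (c * |U p.2 p.1|)) (μ.prod P) := by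
  simpa using h.integrable_mul_exp_abs measurable_id (integrable_const (1 : ℝ)) (ν := P) c

lemma integrable_expMoment (h : IsGaussianField μ U K v) (P : Measure S)
    [IsProbabilityMeasure P] (c : ℝ) :
    Integrable (fun ω => expMoment P (fun y => U y ω) c) μ :=
  (h.integrable_exp_abs_prod P c).integral_prod_left

lemma ae_integrable_exp_abs (h : IsGaussianField μ U K v) (P : ι → Measure S)
    [∀ i, IsProbabilityMeasure (P i)] :
    ∀ᵐ ω ∂μ, ∀ i, ∀ c : ℝ, Integrable (fun y => Real.exp (c * |U y ω|)) (P i) := by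
  rw [ae_all_iff]
  intro i
  -- Countably many exponents give one null set that works for every real `c`, by monotonicity in
  -- `c`.
  have h1 : ∀ᵐ ω ∂μ, ∀ n : ℕ, Integrable (fun y => Real.exp (n * |U y ω|)) (P i) :=
    ae_all_iff.2 fun n => (h.integrable_exp_abs_prod (P i) n).prod_right_ae
  filter_upwards [h1] with ω hω c
  obtain ⟨n, hn⟩ := exists_nat_ge c
  refine (hω n).mono' ((h.measurable_section ω).abs.const_mul c).exp.aestronglyMeasurable
    (.of_forall fun y => ?_)
  rw [Real.norm_of_nonneg (Real.exp_pos _).le]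
  exact Real.exp_le_exp.2 (mul_le_mul_of_nonneg_right hn (abs_nonneg _))

variable {P : ι → Measure S} [∀ i, IsProbabilityMeasure (P i)]

lemma integrable_mul_dominant (h : IsGaussianField μ U K v) {B : (ι → S) → ℝ}
    (hB : Integrable B (Measure.pi P)) (C : ℝ) :
    Integrable (fun p : Ω × (ι → S) => B p.2 * dominant P (fun y => U y p.1) C p.2)
      (μ.prod (Measure.pi P)) := by
  have h1 : ∀ i, Integrable (fun p : Ω × (ι → S) => B p.2 * expMoment (P i) (fun y => U y p.1) C)
      (μ.prod (Measure.pi P)) := fun i => by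
    simpa [mul_comm] using (h.integrable_expMoment (P i) C).mul_prod hB
  have h2 : ∀ i, Integrable (fun p : Ω × (ι → S) => B p.2 * Real.exp (C * |U (p.2 i) p.1|))
      (μ.prod (Measure.pi P)) := fun i =>
    h.integrable_mul_exp_abs (x := fun X : ι → S => X i) (measurable_pi_apply i) hB C
  have h3 := (hB.comp_snd μ).add
    (integrable_finsetSum Finset.univ fun i _ => (h2 i).add (h1 i))
  refine h3.congr (.of_forall fun p => ?_)
  simp only [dominant, Pi.add_apply, mul_add, mul_one, Finset.mul_sum]

lemma integrable_dominant (h : IsGaussianField μ U K v) (X : ι → S) (C : ℝ) :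
    Integrable (fun ω => dominant P (fun y => U y ω) C X) μ :=
  (integrable_const _).add (integrable_finsetSum _ fun i _ =>
    (h.integrable_exp_abs (X i) C).add (h.integrable_expMoment (P i) C))

/-- Domination of a function on `Ω × S^ι` by `|B| w`. -/
lemma integrable_of_le_weight (h : IsGaussianField μ U K v) {B : (ι → S) → ℝ}
    (hB : Integrable B (Measure.pi P)) (β : ℝ) {f : Ω × (ι → S) → ℝ}
    (hf : AEStronglyMeasurable f (μ.prod (Measure.pi P)))
    (hle : ∀ p, ‖f p‖ ≤ ‖B p.2‖ * gibbsWeight P (fun y => β * U y p.1) p.2) :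
    Integrable f (μ.prod (Measure.pi P)) := by
  refine (h.integrable_mul_dominant hB.norm (6 * Fintype.card ι * (|β| + 1))).mono' hf ?_
  have hE := Measure.quasiMeasurePreserving_fst.ae (h.ae_integrable_exp_abs P)
    (μa := μ.prod (Measure.pi P))
  filter_upwards [hE] with p hp
  exact (hle p).trans (mul_le_mul_of_nonneg_left
    (gibbsWeight_le_dominant (h.measurable_section p.1) hp le_rfl p.2) (norm_nonneg _))

lemma integrable_mul_weight (h : IsGaussianField μ U K v) {B : (ι → S) → ℝ}
    (hB : Integrable B (Measure.pi P)) (β : ℝ) :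
    Integrable (fun p : Ω × (ι → S) => B p.2 * gibbsWeight P (fun y => β * U y p.1) p.2)
      (μ.prod (Measure.pi P)) :=
  h.integrable_of_le_weight hB β (hB.1.comp_snd.mul (h.measurable_weight β).aestronglyMeasurable)
    fun p => by rw [norm_mul, Real.norm_of_nonneg (gibbsWeight_nonneg _ _ _)]

/-- Dominated differentiation on the product space. The Gibbs average of `U` is still present here;
replicas remove it afterwards. -/
lemma hasDerivAt_tiltedMean_aux (h : IsGaussianField μ U K v) {B : (ι → S) → ℝ}
    (hB : Integrable B (Measure.pi P)) (β : ℝ) :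
    Integrable (fun p : Ω × (ι → S) => B p.2 * (gibbsWeight P (fun y => β * U y p.1) p.2 *
        ∑ i, (U (p.2 i) p.1 - gibbsAvg (P i) (fun y => β * U y p.1) fun y => U y p.1)))
      (μ.prod (Measure.pi P)) ∧
    HasDerivAt (fun β => tiltedMean μ U P β B)
      (∫ p : Ω × (ι → S), B p.2 * (gibbsWeight P (fun y => β * U y p.1) p.2 *
        ∑ i, (U (p.2 i) p.1 - gibbsAvg (P i) (fun y => β * U y p.1) fun y => U y p.1))
      ∂(μ.prod (Measure.pi P))) β := by
  have heq : (fun β => tiltedMean μ U P β B) = fun β =>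
      ∫ p : Ω × (ι → S), B p.2 * gibbsWeight P (fun y => β * U y p.1) p.2
        ∂(μ.prod (Measure.pi P)) :=
    funext fun β => (integral_prod _ (h.integrable_mul_weight hB β)).symm
  rw [heq]
  have hE := Measure.quasiMeasurePreserving_fst.ae (h.ae_integrable_exp_abs P)
    (μa := μ.prod (Measure.pi P))
  refine hasDerivAt_integral_of_dominated_loc_of_deriv_le (Metric.ball_mem_nhds β one_pos)
    (bound := fun p => ‖B p.2‖ * dominant P (fun y => U y p.1)
      (6 * Fintype.card ι * (|β| + 1 + 1)) p.2 * (2 * Fintype.card ι))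
    (F' := fun β (p : Ω × (ι → S)) => B p.2 * (gibbsWeight P (fun y => β * U y p.1) p.2 *
        ∑ i, (U (p.2 i) p.1 - gibbsAvg (P i) (fun y => β * U y p.1) fun y => U y p.1)))
    (.of_forall fun s => (h.integrable_mul_weight hB s).1) (h.integrable_mul_weight hB β)
    ?_ ?_ ((h.integrable_mul_dominant hB.norm _).mul_const _) ?_
  · refine hB.1.comp_snd.mul ((h.measurable_weight β).mul
      (Finset.measurable_fun_sum _ fun i _ => ?_)).aestronglyMeasurable
    have h1 : Measurable fun p : Ω × (ι → S) => U (p.2 i) p.1 :=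
      h.measurable.comp (f := fun p : Ω × (ι → S) => (p.2 i, p.1))
        (((measurable_pi_apply i).comp measurable_snd).prodMk measurable_fst)
    exact h1.sub ((measurable_gibbsAvg
        (e := fun ω y => β * U y ω) (h := fun ω y => U y ω) (h.measurable_energy β)
        h.measurable_swap).comp measurable_fst)
  · filter_upwards [hE] with p hp s hs
    rw [norm_mul, mul_assoc]
    refine mul_le_mul_of_nonneg_left ?_ (norm_nonneg _)
    rw [Real.norm_eq_abs]
    refine abs_weight_mul_sum_le (h.measurable_section p.1) hp ?_ p.2
    rw [Metric.mem_ball, Real.dist_eq] at hs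
    have := abs_add_le (s - β) β
    rw [sub_add_cancel] at this
    linarith
  · filter_upwards [hE] with p hp s _
    have := hasDerivAt_gibbsWeight (a := fun _ => 0) (h.measurable_section p.1)
      (fun i t => by simpa using integrable_exp_mul (h.measurable_section p.1) (hp i) t) p.2 s
    simp only [zero_add] at this
    exact this.const_mul _

end IsGaussianField

/-! ### Gaussian integration by parts against Gibbs weights -/

/-- Stein's identity: the density `φ` satisfies `φ' u = -(u / v) φ u`, and integrability of the
products kills the boundary terms. -/
lemma integral_mul_gaussianReal {v : ℝ≥0} (hv : v ≠ 0) {f f' : ℝ → ℝ}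
    (hf : ∀ u, HasDerivAt f (f' u) u) (hi : Integrable f (gaussianReal 0 v))
    (hi' : Integrable f' (gaussianReal 0 v))
    (hui : Integrable (fun u => u * f u) (gaussianReal 0 v)) :
    ∫ u, u * f u ∂(gaussianReal 0 v) = v * ∫ u, f' u ∂(gaussianReal 0 v) := by
  have hv' : (v : ℝ) ≠ 0 := by exact_mod_cast hv
  have hInt : ∀ g : ℝ → ℝ, Integrable g (gaussianReal 0 v) →
      Integrable fun u => gaussianPDFReal 0 v u * g u := fun g hg => by
    rw [gaussianReal_of_var_ne_zero _ hv, integrable_withDensity_iff_integrable_smul'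
      (measurable_gaussianPDF _ _) (.of_forall fun _ => gaussianPDF_lt_top)] at hg
    simpa only [toReal_gaussianPDF, smul_eq_mul] using hg
  have hder : ∀ u, HasDerivAt (gaussianPDFReal 0 v) (-(u / v) * gaussianPDFReal 0 v u) u := by
    intro u
    rw [gaussianPDFReal_def]
    have h1 : HasDerivAt (fun x : ℝ => -(x - 0) ^ 2 / (2 * v)) (-(u / v)) u := by
      have := (((hasDerivAt_id u).sub_const 0).pow 2).neg.div_const (2 * (v : ℝ))
      refine this.congr_deriv ?_
      simp
      field_simp
    refine (h1.exp.const_mul _).congr_deriv ?_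
    ring
  have key := integral_mul_deriv_eq_deriv_mul_of_integrable (u := f) (v := gaussianPDFReal 0 v)
    (fun x _ => hf x) (fun x _ => hder x) ?_ ?_ ?_
  · rw [integral_gaussianReal_eq_integral_smul hv, integral_gaussianReal_eq_integral_smul hv]
    simp only [smul_eq_mul]
    have h1 : ∫ u, gaussianPDFReal 0 v u * (u * f u) =
        -v * ∫ u, f u * (-(u / v) * gaussianPDFReal 0 v u) := by
      rw [← integral_const_mul]
      refine integral_congr_ae (.of_forall fun u => ?_)
      simp only
      field_simp
    rw [h1, key, neg_mul_neg]
    simp only [mul_comm]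
  · refine ((hInt _ hui).const_mul (-(v : ℝ)⁻¹)).congr (.of_forall fun u => ?_)
    simp only [Pi.mul_apply]
    field_simp
  · exact (hInt _ hi').congr (.of_forall fun u => mul_comm _ _)
  · exact (hInt _ hi).congr (.of_forall fun u => mul_comm _ _)

section Selector

variable {S : Type*} [TopologicalSpace S] [TopologicalSpace.SeparableSpace S] [Nonempty S]
  [MeasurableSpace S]
  [OpensMeasurableSpace S]

/-- Taking the first point of a dense sequence within `2⁻ⁿ` makes the choice measurable. Here `d`
need not be a metric: only continuity and vanishing on the diagonal matter. -/
lemma exists_measurable_selector {d : S → S → ℝ} (hd : Continuous fun p : S × S => d p.1 p.2)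
    (hd0 : ∀ x, d x x = 0) :
    ∃ k : ℕ → S → ℕ, (∀ n, Measurable (k n)) ∧
      ∀ n x, d x (TopologicalSpace.denseSeq S (k n x)) < (1 / 2) ^ n := by
  classical
  have hex : ∀ n : ℕ, ∀ x, ∃ m, d x (TopologicalSpace.denseSeq S m) < (1 / 2) ^ n := fun n x => by
    have hopen : IsOpen {y | d x y < (1 / 2) ^ n} :=
      isOpen_lt (hd.comp (Continuous.prodMk_right x)) continuous_const
    obtain ⟨m, hm⟩ := (TopologicalSpace.denseRange_denseSeq S).exists_mem_open hopen
      ⟨x, by simp only [mem_ofPred_eq, hd0]; positivity⟩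
    exact ⟨m, hm⟩
  refine ⟨fun n x => Nat.find (hex n x), fun n => measurable_find _ fun m => ?_,
    fun n x => Nat.find_spec (hex n x)⟩
  exact (isOpen_lt (hd.comp (Continuous.prodMk_left _)) continuous_const).measurableSet

end Selector

/-- Summable second moments make `∑ (f n - g)²` finite almost everywhere, so its terms tend to zero.
-/
lemma ae_tendsto_of_integral_sq_le {Ω : Type*} [MeasurableSpace Ω] {μ : Measure Ω}
    {f : ℕ → Ω → ℝ} {g : Ω → ℝ} (hInt : ∀ n, Integrable (fun ω => (f n ω - g ω) ^ 2) μ)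
    (hle : ∀ n, ∫ ω, (f n ω - g ω) ^ 2 ∂μ ≤ (1 / 2) ^ n) :
    ∀ᵐ ω ∂μ, Filter.Tendsto (fun n => f n ω) Filter.atTop (nhds (g ω)) := by
  have h1 : ∫⁻ ω, ∑' n, ENNReal.ofReal ((f n ω - g ω) ^ 2) ∂μ ≠ ⊤ := by
    rw [lintegral_tsum fun n => (hInt n).1.aemeasurable.ennreal_ofReal]
    have h2 : ∀ n, ∫⁻ ω, ENNReal.ofReal ((f n ω - g ω) ^ 2) ∂μ ≤ ENNReal.ofReal ((1 / 2) ^ n) :=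
      fun n => by
        rw [← ofReal_integral_eq_lintegral_ofReal (hInt n) (.of_forall fun _ => sq_nonneg _)]
        exact ENNReal.ofReal_le_ofReal (hle n)
    refine ne_top_of_le_ne_top ?_ (ENNReal.tsum_le_tsum h2)
    rw [← ENNReal.ofReal_tsum_of_nonneg (fun n => by positivity) summable_geometric_two]
    exact ENNReal.ofReal_ne_top
  have h3 := ae_lt_top' (AEMeasurable.tsum fun n => (hInt n).1.aemeasurable.ennreal_ofReal) h1
  filter_upwards [h3] with ω hω
  have h4 := ENNReal.tendsto_atTop_zero_of_tsum_ne_top hω.ne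
  have h5 := (ENNReal.tendsto_toReal ENNReal.zero_ne_top).comp h4
  have h6 : Filter.Tendsto (fun n => (f n ω - g ω) ^ 2) Filter.atTop (nhds 0) := by
    refine h5.congr fun n => ?_
    simp [ENNReal.toReal_ofReal (sq_nonneg _)]
  have h7 : Filter.Tendsto (fun n => |f n ω - g ω|) Filter.atTop (nhds 0) := by
    have := (Real.continuous_sqrt.tendsto 0).comp h6
    rw [Real.sqrt_zero] at this
    exact this.congr fun n => Real.sqrt_sq_eq_abs _
  exact tendsto_iff_dist_tendsto_zero.2 h7

/-- The measurable reconstruction of a field from its values at countably many points. -/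
def reconstruct {S : Type*} (k : ℕ → S → ℕ) (x : S) (η : ℕ → ℝ) : ℝ :=
  Filter.limsup (fun n => η (k n x)) Filter.atTop

/-- A `limsup` is measurable whether or not the sequence converges, so the reconstruction is jointly
measurable on all of `S × (ℕ → ℝ)`. -/
lemma measurable_reconstruct {S : Type*} [MeasurableSpace S] {k : ℕ → S → ℕ}
    (hk : ∀ n, Measurable (k n)) : Measurable fun p : S × (ℕ → ℝ) => reconstruct k p.1 p.2 := by
  refine Measurable.limsup fun n => ?_
  have h1 : Measurable fun p : ℕ × (ℕ → ℝ) => p.2 p.1 :=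
    measurable_from_prod_countable_right fun m => measurable_pi_apply m
  exact h1.comp (((hk n).comp measurable_fst).prodMk measurable_snd)

section Gibbs

variable {S : Type*} [MeasurableSpace S] {P : Measure S}

lemma gibbs_congr {e e' : S → ℝ} (h : e =ᵐ[P] e') {x : S} (hx : e x = e' x) :
    gibbs P e x = gibbs P e' x := by
  have : ∫ y, Real.exp (e y) ∂P = ∫ y, Real.exp (e' y) ∂P :=
    integral_congr_ae (h.mono fun y hy => by simp only [hy])
  rw [gibbs, gibbs, hx, this]

lemma gibbsAvg_congr {e e' : S → ℝ} (h : e =ᵐ[P] e') (f : S → ℝ) :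
    gibbsAvg P e f = gibbsAvg P e' f :=
  integral_congr_ae (h.mono fun y hy => by simp only [gibbs_congr h hy])

lemma gibbsAvg_const_mul (e f : S → ℝ) (a : ℝ) :
    gibbsAvg P e (fun y => a * f y) = a * gibbsAvg P e f := by
  simp only [gibbsAvg, mul_assoc, integral_const_mul]

/-- Without integrability of `exp e` the partition function is `0` by convention, and so is the
Gibbs density; the bound therefore holds for every `ω`. -/
lemma abs_gibbsAvg_le_of_bound {e f : S → ℝ} {M : ℝ} (hM : 0 ≤ M) (hf : ∀ y, |f y| ≤ M) :
    |gibbsAvg P e f| ≤ M := by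
  by_cases hi : Integrable (fun y => Real.exp (e y)) P
  · have hg : Integrable (gibbs P e) P := hi.div_const _
    have h1 : ∫ y, gibbs P e y ∂P ≤ 1 := by
      simp only [gibbs]
      rw [integral_div]
      exact div_self_le_one _
    refine (abs_integral_le_integral_abs).trans ?_
    refine (integral_mono_of_nonneg (.of_forall fun _ => abs_nonneg _) (hg.const_mul M)
      (.of_forall fun y => ?_)).trans ?_
    · simp only [abs_mul, abs_of_nonneg (gibbs_nonneg P e y)]
      exact mul_le_mul_of_nonneg_right (hf y) (gibbs_nonneg _ _ _)
    · rw [integral_const_mul]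
      exact mul_le_of_le_one_right hM h1
  · have : gibbs P e = fun _ => 0 := funext fun y => by rw [gibbs, integral_undef hi, div_zero]
    simpa [gibbsAvg, this] using hM

end Gibbs

namespace IsGaussianField

variable {S Ω ι : Type*} [TopologicalSpace S] [MeasurableSpace S] [MeasurableSpace Ω] [Fintype ι]
  {μ : Measure Ω} {U : S → Ω → ℝ} {K : S → S → ℝ} {v : ℝ≥0}

lemma integrable_mul (h : IsGaussianField μ U K v) (x y : S) :
    Integrable (fun ω => U x ω * U y ω) μ :=
  (h.memLp_two x).integrable_mul (h.memLp_two y)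

lemma cov_symm (h : IsGaussianField μ U K v) (x y : S) : K x y = K y x := by
  rw [← h.covariance, ← h.covariance]
  simp only [mul_comm]

lemma abs_cov_le (h : IsGaussianField μ U K v) (x y : S) : |K x y| ≤ v := by
  have h1 : ∀ x, ∫ ω, U x ω * U x ω ∂μ = v := fun x => by rw [h.covariance, h.diag]
  have h2 : ∫ ω, (U x ω * U x ω + U y ω * U y ω) / 2 ∂μ = v := by
    rw [integral_div, integral_add (h.integrable_mul x x) (h.integrable_mul y y), h1, h1]
    ring
  rw [← h.covariance, ← h2]
  refine (abs_integral_le_integral_abs).trans (integral_mono (h.integrable_mul x y).abs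
    (((h.integrable_mul x x).add (h.integrable_mul y y)).div_const 2) fun ω => ?_)
  simp only
  rw [abs_le]
  constructor <;> nlinarith [sq_nonneg (U x ω + U y ω), sq_nonneg (U x ω - U y ω)]

lemma integral_sq_sub (h : IsGaussianField μ U K v) (x y : S) :
    Integrable (fun ω => (U x ω - U y ω) ^ 2) μ ∧
      ∫ ω, (U x ω - U y ω) ^ 2 ∂μ = K x x - 2 * K x y + K y y := by
  have h1 : (fun ω => (U x ω - U y ω) ^ 2) = fun ω =>
      U x ω * U x ω - 2 * (U x ω * U y ω) + U y ω * U y ω := by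
    funext ω; ring
  have hi : Integrable (fun ω => U x ω * U x ω - 2 * (U x ω * U y ω)) μ :=
    (h.integrable_mul x x).sub ((h.integrable_mul x y).const_mul 2)
  refine ⟨?_, ?_⟩
  · rw [h1]
    exact hi.add (h.integrable_mul y y)
  · rw [h1, integral_add hi (h.integrable_mul y y),
      integral_sub (h.integrable_mul x x) ((h.integrable_mul x y).const_mul 2),
      integral_const_mul, h.covariance, h.covariance, h.covariance]

/-- The part of the field that is orthogonal to its value at `z`. -/
def residual (U : S → Ω → ℝ) (K : S → S → ℝ) (v : ℝ≥0) (z y : S) (ω : Ω) : ℝ :=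
  U y ω - K z y / v * U z ω

/-- Regression on the value at `z`: the coefficient `K z y / v` makes the residual uncorrelated with
`U z`, and jointly Gaussian uncorrelated families are independent. -/
lemma indepFun_residual [IsProbabilityMeasure μ] (h : IsGaussianField μ U K v) (hv : v ≠ 0)
    (z : S) (s : ℕ → S) :
    IndepFun (fun ω m => residual U K v z (s m) ω) (U z) μ := by
  classical
  have hv' : (v : ℝ) ≠ 0 := by exact_mod_cast hv
  have hm : ∀ y, Measurable (residual U K v z y) := fun y =>
    (h.measurable_apply y).sub ((h.measurable_apply z).const_mul _)
  have hG : IsGaussianProcess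
      (Sum.elim (fun m => residual U K v z (s m)) (fun _ : Unit => U z)) μ := by
    refine IsGaussianProcess.of_isGaussianProcess h.gaussian fun i => ?_
    rcases i with m | i
    · refine ⟨{s m, z}, ContinuousLinearMap.proj (R := ℝ) (φ := fun _ => ℝ) ⟨s m, by simp⟩ -
        (K z (s m) / v) • ContinuousLinearMap.proj (R := ℝ) (φ := fun _ => ℝ) ⟨z, by simp⟩,
        fun ω => ?_⟩
      simp [residual]
    · exact ⟨{z}, ContinuousLinearMap.proj (R := ℝ) (φ := fun _ => ℝ) ⟨z, by simp⟩,
        fun ω => by simp⟩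
  have hind := hG.indepFun_of_covariance_eq_zero (fun m => (hm (s m)).aemeasurable)
    (fun _ => (h.measurable_apply z).aemeasurable) fun m _ => ?_
  · exact hind.comp measurable_id (measurable_pi_apply ())
  · have hL : MemLp (residual U K v z (s m)) 2 μ :=
      (h.memLp_two (s m)).sub ((h.memLp_two z).const_mul _)
    rw [covariance_eq_sub hL (h.memLp_two z), h.mean z, mul_zero, sub_zero]
    have h1 : (residual U K v z (s m) * U z) = fun ω =>
        U (s m) ω * U z ω - K z (s m) / v * (U z ω * U z ω) := by
      funext ω
      simp only [Pi.mul_apply, residual]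
      ring
    rw [h1, integral_sub (h.integrable_mul _ _) ((h.integrable_mul _ _).const_mul _),
      integral_const_mul, h.covariance, h.covariance, h.diag, h.cov_symm (s m) z]
    field_simp
    ring

/-- A partition function depends on the field at uncountably many points, whereas independence is
available for a sequence of residuals. Continuity of `K` makes the residual continuous in mean
square, so its values on a dense sequence recover it almost surely at each point. -/
lemma exists_reconstruct [TopologicalSpace.SeparableSpace S] [OpensMeasurableSpace S]
    (h : IsGaussianField μ U K v) (z : S) :
    ∃ (s : ℕ → S) (k : ℕ → S → ℕ), (∀ n, Measurable (k n)) ∧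
      ∀ y, ∀ᵐ ω ∂μ, reconstruct k y (fun m => residual U K v z (s m) ω) =
        residual U K v z y ω := by
  have : Nonempty S := ⟨z⟩
  have hK := h.continuous
  have hc : Continuous fun y => K z y / v := (hK.comp (Continuous.prodMk_right z)).div_const _
  -- This `d` bounds the mean square of the difference of two residuals, through `(a - b)² ≤ 2 a² +
  -- 2 b²`.
  obtain ⟨k, hk, hkd⟩ := exists_measurable_selector (S := S)
    (d := fun x y => 2 * (K y y - 2 * K y x + K x x) + 2 * ((K z y / v - K z x / v) ^ 2 * v))
    (by
      have h11 : Continuous fun p : S × S => K p.1 p.1 :=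
        hK.comp (continuous_fst.prodMk continuous_fst)
      have h22 : Continuous fun p : S × S => K p.2 p.2 :=
        hK.comp (continuous_snd.prodMk continuous_snd)
      have h21 : Continuous fun p : S × S => K p.2 p.1 :=
        hK.comp (continuous_snd.prodMk continuous_fst)
      have hc1 := hc.comp (continuous_fst (X := S) (Y := S))
      have hc2 := hc.comp (continuous_snd (X := S) (Y := S))
      simp only [Function.comp_def] at hc1 hc2
      fun_prop)
    (fun x => by ring)
  refine ⟨TopologicalSpace.denseSeq S, k, hk, fun y => ?_⟩
  have hle : ∀ x, Integrable (fun ω => (residual U K v z x ω - residual U K v z y ω) ^ 2) μ ∧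
      ∫ ω, (residual U K v z x ω - residual U K v z y ω) ^ 2 ∂μ ≤
        2 * (K x x - 2 * K x y + K y y) + 2 * ((K z x / v - K z y / v) ^ 2 * v) := fun x => by
    obtain ⟨h1, h2⟩ := h.integral_sq_sub x y
    have h3 : Integrable (fun ω => 2 * (U x ω - U y ω) ^ 2 +
        2 * ((K z x / v - K z y / v) ^ 2 * (U z ω * U z ω))) μ :=
      (h1.const_mul 2).add (((h.integrable_mul z z).const_mul _).const_mul 2)
    have h4 : ∀ ω, (residual U K v z x ω - residual U K v z y ω) ^ 2 ≤
        2 * (U x ω - U y ω) ^ 2 + 2 * ((K z x / v - K z y / v) ^ 2 * (U z ω * U z ω)) := fun ω => by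
      simp only [residual]
      nlinarith [sq_nonneg ((U x ω - U y ω) + (K z x / v - K z y / v) * U z ω)]
    have h5 : Measurable fun ω => (residual U K v z x ω - residual U K v z y ω) ^ 2 :=
      (((h.measurable_apply x).sub ((h.measurable_apply z).const_mul _)).sub
        ((h.measurable_apply y).sub ((h.measurable_apply z).const_mul _))).pow_const 2
    have h6 : Integrable (fun ω => (residual U K v z x ω - residual U K v z y ω) ^ 2) μ :=
      h3.mono' h5.aestronglyMeasurable (.of_forall fun ω => by
        rw [Real.norm_of_nonneg (sq_nonneg _)]; exact h4 ω)
    refine ⟨h6, (integral_mono h6 h3 h4).trans (le_of_eq ?_)⟩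
    rw [integral_add (h1.const_mul 2) (((h.integrable_mul z z).const_mul _).const_mul 2),
      integral_const_mul, integral_const_mul, integral_const_mul, h2, h.covariance, h.diag z]
  filter_upwards [ae_tendsto_of_integral_sq_le
    (f := fun n => residual U K v z (TopologicalSpace.denseSeq S (k n y)))
    (fun n => (hle _).1) fun n => (hle _).2.trans (hkd n y).le] with ω hω
  exact hω.limsup_eq

end IsGaussianField

/-- Independence makes the joint law a product, so Stein's identity applies in the last variable
with `q` frozen. -/
lemma integral_mul_eq_of_indepFun {Ω T : Type*} [MeasurableSpace Ω] [MeasurableSpace T]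
    {μ : Measure Ω} [IsProbabilityMeasure μ] {η : Ω → T} {ξ : Ω → ℝ} (hη : Measurable η)
    (hξ : Measurable ξ) (hind : IndepFun η ξ μ) {v : ℝ≥0} (hv : v ≠ 0)
    (hlaw : μ.map ξ = gaussianReal 0 v) {Φ Φ' : T × ℝ → ℝ} (hΦ : Measurable Φ)
    (hΦ' : Measurable Φ')
    (hder : ∀ᵐ q ∂(μ.map η), ∀ u, HasDerivAt (fun u => Φ (q, u)) (Φ' (q, u)) u)
    (hi : Integrable (fun ω => Φ (η ω, ξ ω)) μ)
    (hξi : Integrable (fun ω => ξ ω * Φ (η ω, ξ ω)) μ)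
    (hi' : Integrable (fun ω => Φ' (η ω, ξ ω)) μ) :
    ∫ ω, ξ ω * Φ (η ω, ξ ω) ∂μ = v * ∫ ω, Φ' (η ω, ξ ω) ∂μ := by
  have hpair : Measurable fun ω => (η ω, ξ ω) := hη.prodMk hξ
  have hmap : μ.map (fun ω => (η ω, ξ ω)) = (μ.map η).prod (gaussianReal 0 v) := by
    rw [← hlaw]
    exact (indepFun_iff_map_prod_eq_prod_map_map hη.aemeasurable hξ.aemeasurable).1 hind
  have hprob : IsProbabilityMeasure (μ.map η) := Measure.isProbabilityMeasure_map hη.aemeasurable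
  have tr : ∀ f : T × ℝ → ℝ, Measurable f → Integrable (fun ω => f (η ω, ξ ω)) μ →
      Integrable f ((μ.map η).prod (gaussianReal 0 v)) := fun f hf hfi => by
    rw [← hmap]
    exact (integrable_map_measure hf.aestronglyMeasurable hpair.aemeasurable).2 hfi
  have tri : ∀ f : T × ℝ → ℝ, Measurable f → Integrable (fun ω => f (η ω, ξ ω)) μ →
      ∫ ω, f (η ω, ξ ω) ∂μ = ∫ q, ∫ u, f (q, u) ∂(gaussianReal 0 v) ∂(μ.map η) :=
    fun f hf hfi => by
      rw [← integral_prod _ (tr f hf hfi), ← hmap,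
        integral_map hpair.aemeasurable hf.aestronglyMeasurable]
  have hξm : Measurable fun p : T × ℝ => p.2 * Φ p := measurable_snd.mul hΦ
  rw [tri (fun p => p.2 * Φ p) hξm hξi, tri Φ' hΦ' hi', ← integral_const_mul]
  refine integral_congr_ae ?_
  filter_upwards [hder, (tr _ hΦ hi).prod_right_ae, (tr _ hΦ' hi').prod_right_ae,
    (tr _ hξm hξi).prod_right_ae] with q h1 h2 h3 h4
  exact integral_mul_gaussianReal hv h1 h2 h3 h4

/-- The energy `β (V + u c)`, with `V` reconstructed from its values at countably many points. -/
def splitEnergy {S : Type*} (β : ℝ) (k : ℕ → S → ℕ) (c : S → ℝ) (q : (ℕ → ℝ) × ℝ) (y : S) : ℝ :=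
  β * reconstruct k y q.1 + q.2 * (β * c y)

lemma measurable_splitEnergy {S : Type*} [MeasurableSpace S] (β : ℝ) {k : ℕ → S → ℕ}
    (hk : ∀ n, Measurable (k n)) {c : S → ℝ} (hc : Measurable c) :
    Measurable fun p : ((ℕ → ℝ) × ℝ) × S => splitEnergy β k c p.1 p.2 := by
  have h1 : Measurable fun p : ((ℕ → ℝ) × ℝ) × S => reconstruct k p.2 p.1.1 :=
    (measurable_reconstruct hk).comp
      (f := fun p : ((ℕ → ℝ) × ℝ) × S => (p.2, p.1.1))
      (measurable_snd.prodMk (measurable_fst.comp measurable_fst))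
  exact (h1.const_mul β).add
    ((measurable_snd.comp measurable_fst).mul ((hc.comp measurable_snd).const_mul β))

namespace IsGaussianField

variable {S Ω ι : Type*} [TopologicalSpace S] [MeasurableSpace S] [MeasurableSpace Ω] [Fintype ι]
  {μ : Measure Ω} {U : S → Ω → ℝ} {K : S → S → ℝ} {v : ℝ≥0}
  {P : ι → Measure S}

lemma measurable_weight_apply [∀ i, SFinite (P i)] (h : IsGaussianField μ U K v) (β : ℝ)
    (X : ι → S) :
    Measurable fun ω => gibbsWeight P (fun y => β * U y ω) X :=
  measurable_gibbsWeight (e := fun ω y => β * U y ω) (h.measurable_energy β) measurable_const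

lemma abs_sum_cov_sub_le (h : IsGaussianField μ U K v) (e : S → ℝ) (X : ι → S) (x : S) :
    |∑ k, (K x (X k) - gibbsAvg (P k) e (K x))| ≤ Fintype.card ι * (2 * v) := by
  refine (Finset.abs_sum_le_sum_abs _ _).trans ((Finset.sum_le_sum fun k _ =>
    (abs_sub _ _).trans (add_le_add (h.abs_cov_le _ _)
      (abs_gibbsAvg_le_of_bound v.2 fun y => h.abs_cov_le x y))).trans (le_of_eq ?_))
  rw [Finset.sum_const, Finset.card_univ, nsmul_eq_mul]
  simp only [NNReal.val_eq_coe]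
  ring

lemma measurable_residual (h : IsGaussianField μ U K v) {z : S} (hK : Measurable (K z)) :
    Measurable fun p : S × Ω => residual U K v z p.1 p.2 :=
  h.measurable.sub (((hK.div_const _).comp measurable_fst).mul
    ((h.measurable_apply z).comp measurable_snd))

variable [IsProbabilityMeasure μ] [∀ i, IsProbabilityMeasure (P i)]

lemma integrable_weight (h : IsGaussianField μ U K v) (β : ℝ)
    (X : ι → S) :
    Integrable (fun ω => gibbsWeight P (fun y => β * U y ω) X) μ := by
  refine (h.integrable_dominant (P := P) X (6 * Fintype.card ι * (|β| + 1))).mono'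
    (h.measurable_weight_apply β X).aestronglyMeasurable ?_
  filter_upwards [h.ae_integrable_exp_abs P] with ω hω
  rw [Real.norm_of_nonneg (gibbsWeight_nonneg _ _ _)]
  exact gibbsWeight_le_dominant (h.measurable_section ω) hω le_rfl X

lemma integrable_mul_weight_apply (h : IsGaussianField μ U K v) (β : ℝ) (X : ι → S) (j : ι) :
    Integrable (fun ω => U (X j) ω * gibbsWeight P (fun y => β * U y ω) X) μ := by
  refine ((h.integrable_dominant (P := P) X (6 * Fintype.card ι * (|β| + 1))).const_mul 2).mono'
    ((h.measurable_apply _).mul (h.measurable_weight_apply β X)).aestronglyMeasurable ?_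
  filter_upwards [h.ae_integrable_exp_abs P] with ω hω
  refine le_trans ?_ (gibbsWeight_mul_le_dominant (h.measurable_section ω) hω le_rfl X j)
  rw [norm_mul, mul_comm, Real.norm_of_nonneg (gibbsWeight_nonneg _ _ _), Real.norm_eq_abs]
  exact mul_le_mul_of_nonneg_left (le_add_of_nonneg_right (integral_nonneg fun y =>
    mul_nonneg (abs_nonneg _) (gibbs_nonneg _ _ _))) (gibbsWeight_nonneg _ _ _)

/-- The exceptional null set depends on the point; Fubini exchanges the quantifiers, and equality
for `P`-almost every point is all that a partition function sees. -/
lemma ae_ae_reconstruct_eq (h : IsGaussianField μ U K v) {z : S} (hK : Measurable (K z))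
    {s : ℕ → S} {k : ℕ → S → ℕ} (hk : ∀ n, Measurable (k n))
    (hrec : ∀ y, ∀ᵐ ω ∂μ, reconstruct k y (fun m => residual U K v z (s m) ω) =
      residual U K v z y ω) (P : Measure S) [IsProbabilityMeasure P] :
    ∀ᵐ ω ∂μ, ∀ᵐ y ∂P, reconstruct k y (fun m => residual U K v z (s m) ω) =
      residual U K v z y ω := by
  have hη : Measurable fun ω m => residual U K v z (s m) ω := measurable_pi_lambda _ fun m =>
    (h.measurable_residual hK).comp measurable_prodMk_left
  have hset : MeasurableSet {p : S × Ω |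
      reconstruct k p.1 (fun m => residual U K v z (s m) p.2) = residual U K v z p.1 p.2} :=
    measurableSet_eq_fun
      ((measurable_reconstruct hk).comp
        (f := fun p : S × Ω => (p.1, fun m => residual U K v z (s m) p.2))
        (measurable_fst.prodMk (hη.comp measurable_snd))) (h.measurable_residual hK)
  exact (Measure.ae_ae_comm (μ := P) (ν := μ) hset).1 (.of_forall hrec)

lemma residual_exp_le {β : ℝ} {c u ξ : ℝ} (hc : |c| ≤ 1) :
    Real.exp (β * (u - c * ξ)) ≤ Real.exp (|β| * |u|) * Real.exp (|β| * |ξ|) := by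
  rw [← Real.exp_add, ← mul_add]
  refine Real.exp_le_exp.2 ((le_abs_self _).trans ?_)
  rw [abs_mul]
  refine mul_le_mul_of_nonneg_left ((abs_sub _ _).trans (add_le_add le_rfl ?_)) (abs_nonneg _)
  rw [abs_mul]
  exact mul_le_of_le_one_left (abs_nonneg _) hc

/-- Gaussian integration by parts against the Gibbs weight, for `v ≠ 0`. -/
lemma integral_mul_weight_of_ne_zero [TopologicalSpace.SeparableSpace S] [OpensMeasurableSpace S]
    (h : IsGaussianField μ U K v) (hv : v ≠ 0) (β : ℝ) (X : ι → S) (j : ι) :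
    ∫ ω, U (X j) ω * gibbsWeight P (fun y => β * U y ω) X ∂μ =
      β * ∫ ω, gibbsWeight P (fun y => β * U y ω) X *
        ∑ k, (K (X j) (X k) - gibbsAvg (P k) (fun y => β * U y ω) (K (X j))) ∂μ := by
  have hv' : (v : ℝ) ≠ 0 := by exact_mod_cast hv
  obtain ⟨z, hz⟩ : ∃ z, z = X j := ⟨_, rfl⟩
  rw [← hz]
  have hKz : Measurable (K z) := (h.continuous.comp (Continuous.prodMk_right z)).measurable
  obtain ⟨c, hc⟩ : ∃ c : S → ℝ, c = fun y => K z y / v := ⟨_, rfl⟩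
  have hcm : Measurable c := hc ▸ hKz.div_const _
  have hc1 : ∀ y, |c y| ≤ 1 := fun y => by
    rw [hc, abs_div, abs_of_nonneg (NNReal.coe_nonneg v)]
    exact div_le_one_of_le₀ (h.abs_cov_le z y) v.2
  obtain ⟨s, k, hk, hrec⟩ := h.exists_reconstruct z
  have hind := h.indepFun_residual hv z s
  have hrecP : ∀ᵐ ω ∂μ, ∀ i, ∀ᵐ y ∂(P i),
      reconstruct k y (fun m => residual U K v z (s m) ω) = residual U K v z y ω :=
    ae_all_iff.2 fun i => h.ae_ae_reconstruct_eq hKz hk hrec (P i)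
  have hrecX : ∀ᵐ ω ∂μ, ∀ i,
      reconstruct k (X i) (fun m => residual U K v z (s m) ω) = residual U K v z (X i) ω :=
    ae_all_iff.2 fun i => hrec (X i)
  obtain ⟨η, hη⟩ : ∃ η : Ω → ℕ → ℝ, η = fun ω m => residual U K v z (s m) ω := ⟨_, rfl⟩
  have hηm : Measurable η := by
    rw [hη]
    exact measurable_pi_lambda _ fun m => (h.measurable_residual hKz).comp measurable_prodMk_left
  have hηω : ∀ ω, (fun m => residual U K v z (s m) ω) = η ω := fun ω => by rw [hη]
  simp only [hηω] at hrecP hrecX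
  rw [← hη] at hind
  have hen := measurable_splitEnergy β hk hcm
  -- Where the reconstruction succeeds, the energy is affine in `ξ = U z` with slope `β c`, and its
  -- other part depends only on `η`, which is independent of `ξ`.
  have hsplit : ∀ ω y, reconstruct k y (η ω) = residual U K v z y ω →
      splitEnergy β k c (η ω, U z ω) y = β * U y ω := fun ω y hy => by
    rw [splitEnergy, hy, residual, hc]
    ring
  have hae : ∀ᵐ ω ∂μ, (∀ i, splitEnergy β k c (η ω, U z ω) =ᵐ[P i] fun y => β * U y ω) ∧
      ∀ i, splitEnergy β k c (η ω, U z ω) (X i) = β * U (X i) ω := by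
    filter_upwards [hrecP, hrecX] with ω h1 h2
    exact ⟨fun i => (h1 i).mono fun y hy => hsplit ω y hy, fun i => hsplit ω _ (h2 i)⟩
  have hw : ∀ᵐ ω ∂μ, gibbsWeight P (splitEnergy β k c (η ω, U z ω)) X =
      gibbsWeight P (fun y => β * U y ω) X := by
    filter_upwards [hae] with ω hω
    exact Finset.prod_congr rfl fun i _ => gibbs_congr (hω.1 i) (hω.2 i)
  -- The factor `v⁻¹` from `c = K z / v` is cancelled at the end by the `v` of Stein's identity.
  have hw' : ∀ᵐ ω ∂μ, gibbsWeight P (splitEnergy β k c (η ω, U z ω)) X *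
      ∑ i, (β * c (X i) - gibbsAvg (P i) (splitEnergy β k c (η ω, U z ω)) fun y => β * c y) =
      β * (v : ℝ)⁻¹ * (gibbsWeight P (fun y => β * U y ω) X *
        ∑ i, (K z (X i) - gibbsAvg (P i) (fun y => β * U y ω) (K z))) := by
    filter_upwards [hw, hae] with ω h1 h2
    rw [h1, mul_left_comm]
    refine congrArg (gibbsWeight P (fun y => β * U y ω) X * ·) ?_
    rw [Finset.mul_sum]
    refine Finset.sum_congr rfl fun i _ => ?_
    rw [gibbsAvg_congr (h2.1 i)]
    have h3 : (fun y => β * c y) = fun y => β * (v : ℝ)⁻¹ * K z y := by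
      funext y; rw [hc]; ring
    rw [h3, gibbsAvg_const_mul, hc]
    ring
  have hΦ : Measurable fun q : (ℕ → ℝ) × ℝ => gibbsWeight P (splitEnergy β k c q) X :=
    measurable_gibbsWeight hen measurable_const
  have hΦ' : Measurable fun q : (ℕ → ℝ) × ℝ => gibbsWeight P (splitEnergy β k c q) X *
      ∑ i, (β * c (X i) - gibbsAvg (P i) (splitEnergy β k c q) fun y => β * c y) := by
    refine hΦ.mul (Finset.measurable_fun_sum _ fun i _ => measurable_const.sub ?_)
    exact measurable_gibbsAvg hen (h := fun _ y => β * c y)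
      ((hcm.comp measurable_snd).const_mul β)
  have hder : ∀ᵐ q ∂(μ.map η), ∀ u, HasDerivAt
      (fun u => gibbsWeight P (splitEnergy β k c (q, u)) X)
      (gibbsWeight P (splitEnergy β k c (q, u)) X *
        ∑ i, (β * c (X i) - gibbsAvg (P i) (splitEnergy β k c (q, u)) fun y => β * c y)) u := by
    have hrm : ∀ q : ℕ → ℝ, Measurable fun y => β * reconstruct k y q := fun q =>
      ((measurable_reconstruct hk).comp measurable_prodMk_right).const_mul β
    have h1 : ∀ᵐ q ∂(μ.map η), ∀ i, Integrable (fun y => Real.exp (β * reconstruct k y q)) (P i) := by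
      rw [ae_all_iff]
      intro i
      have hm : StronglyMeasurable fun p : (ℕ → ℝ) × S => Real.exp (β * reconstruct k p.2 p.1) :=
        (((measurable_reconstruct hk).comp _root_.measurable_swap).const_mul β).exp.stronglyMeasurable
      rw [ae_map_iff hηm.aemeasurable
        (_root_.measurableSet_integrable (f := fun q y => Real.exp (β * reconstruct k y q)) hm)]
      filter_upwards [hrecP, h.ae_integrable_exp_abs P] with ω h2 h3
      refine ((h3 i |β|).mul_const (Real.exp (|β| * |U z ω|))).mono'
        (hrm _).exp.aestronglyMeasurable ?_
      filter_upwards [h2 i] with y hy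
      rw [Real.norm_of_nonneg (Real.exp_pos _).le, hy, residual]
      exact residual_exp_le (by simpa only [hc] using hc1 y)
    -- Since `|c| ≤ 1`, moving along `u` changes the exponential by a bounded factor, so
    -- integrability at `u = 0` gives it for all `u`.
    filter_upwards [h1] with q hq u
    refine hasDerivAt_gibbsWeight (a := fun y => β * reconstruct k y q) (hcm.const_mul β)
      (fun i t => ?_) X u
    refine ((hq i).mul_const (Real.exp (|t| * |β|))).mono'
      ((hrm q).add ((hcm.const_mul β).const_mul t)).exp.aestronglyMeasurable
      (.of_forall fun y => ?_)
    rw [Real.norm_of_nonneg (Real.exp_pos _).le, Real.exp_add]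
    refine mul_le_mul_of_nonneg_left (Real.exp_le_exp.2 ((le_abs_self _).trans ?_))
      (Real.exp_pos _).le
    rw [abs_mul, abs_mul]
    exact mul_le_mul_of_nonneg_left (mul_le_of_le_one_right (abs_nonneg _) (hc1 y)) (abs_nonneg _)
  have hwi : Integrable (fun ω => gibbsWeight P (fun y => β * U y ω) X *
      ∑ i, (K z (X i) - gibbsAvg (P i) (fun y => β * U y ω) (K z))) μ := by
    refine ((h.integrable_weight (P := P) β X).mul_const (Fintype.card ι * (2 * v))).mono'
      ((h.measurable_weight_apply β X).mul (Finset.measurable_fun_sum _ fun i _ =>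
        measurable_const.sub (measurable_gibbsAvg (h.measurable_energy β)
          (h := fun _ y => K z y) (hKz.comp measurable_snd)))).aestronglyMeasurable
      (.of_forall fun ω => ?_)
    rw [norm_mul, Real.norm_of_nonneg (gibbsWeight_nonneg _ _ _), Real.norm_eq_abs]
    exact mul_le_mul_of_nonneg_left (h.abs_sum_cov_sub_le _ _ _) (gibbsWeight_nonneg _ _ _)
  have key := integral_mul_eq_of_indepFun hηm (h.measurable_apply z) hind hv (h.map_eq z) hΦ hΦ'
    hder ((h.integrable_weight (P := P) β X).congr (hw.mono fun ω hω => hω.symm))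
    ((hz ▸ h.integrable_mul_weight_apply (P := P) β X j).congr
      (hw.mono fun ω hω => by simp only [hω]))
    ((hwi.const_mul (β * (v : ℝ)⁻¹)).congr (hw'.mono fun ω hω => hω.symm))
  rw [integral_congr_ae hw', integral_const_mul] at key
  rw [integral_congr_ae (hw.mono fun ω hω => by simp only [hω] :
    (fun ω => U z ω * gibbsWeight P (splitEnergy β k c (η ω, U z ω)) X) =ᵐ[μ]
      fun ω => U z ω * gibbsWeight P (fun y => β * U y ω) X)] at key
  rw [key]
  field_simp

/-- Gaussian integration by parts against the Gibbs weight. -/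
theorem integral_mul_weight [TopologicalSpace.SeparableSpace S] [OpensMeasurableSpace S]
    (h : IsGaussianField μ U K v) (β : ℝ) (X : ι → S) (j : ι) :
    ∫ ω, U (X j) ω * gibbsWeight P (fun y => β * U y ω) X ∂μ =
      β * ∫ ω, gibbsWeight P (fun y => β * U y ω) X *
        ∑ k, (K (X j) (X k) - gibbsAvg (P k) (fun y => β * U y ω) (K (X j))) ∂μ := by
  -- With zero variance, regression on `U z` is undefined, but the field vanishes almost surely at
  -- each point and both sides are zero.
  by_cases hv : v = 0
  · have hK : ∀ x y, K x y = 0 := fun x y => by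
      have := h.abs_cov_le x y
      rw [hv, NNReal.coe_zero] at this
      exact abs_nonpos_iff.1 this
    have h0 : U (X j) =ᵐ[μ] 0 := by
      have h1 : ∫ ω, U (X j) ω * U (X j) ω ∂μ = 0 := by rw [h.covariance, hK]
      rw [integral_eq_zero_iff_of_nonneg (fun ω => mul_self_nonneg _) (h.integrable_mul _ _)] at h1
      exact h1.mono fun ω hω => mul_self_eq_zero.1 hω
    rw [integral_congr_ae (g := fun _ => 0) (h0.mono fun ω hω => by simp [hω])]
    have h2 : K (X j) = fun _ => 0 := funext fun y => hK _ _
    simp [h2, gibbsAvg]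
  · exact h.integral_mul_weight_of_ne_zero hv β X j

end IsGaussianField

/-! ### Product measures, marginals and products of tilted measures -/

section ProductMeasure

variable {S ι κ : Type*} [MeasurableSpace S]

lemma measurable_comp_index (f : ι → κ) : Measurable fun (X : κ → S) i => X (f i) :=
  measurable_pi_lambda _ fun i => measurable_pi_apply (f i)

variable [Fintype ι] [Fintype κ]

lemma measurePreserving_comp_pi (m : κ → Measure S) [∀ k, IsProbabilityMeasure (m k)] {f : ι → κ}
    (hf : Function.Injective f) :
    MeasurePreserving (fun (X : κ → S) i => X (f i)) (Measure.pi m)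
      (Measure.pi fun i => m (f i)) := by
  classical
  refine ⟨measurable_comp_index f, (Measure.pi_eq fun s hs => ?_).symm⟩
  rw [Measure.map_apply (measurable_comp_index f) (MeasurableSet.univ_pi hs)]
  have hpre : (fun (X : κ → S) i => X (f i)) ⁻¹' univ.pi s =
      univ.pi (Function.extend f s fun _ => univ) := by
    ext X
    simp only [mem_preimage, mem_univ_pi]
    refine ⟨fun h k => ?_, fun h i => by simpa [hf.extend_apply] using h (f i)⟩
    by_cases hk : ∃ i, f i = k
    · obtain ⟨i, rfl⟩ := hk
      simpa [hf.extend_apply] using h i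
    · rw [Function.extend_apply' _ _ _ hk]
      trivial
  rw [hpre, Measure.pi_pi]
  rw [← Finset.prod_subset (Finset.subset_univ (Finset.univ.map ⟨f, hf⟩)), Finset.prod_map]
  · simp [hf.extend_apply]
  · intro k _ hk
    have : ¬∃ i, f i = k := by simpa using hk
    rw [Function.extend_apply' _ _ _ this, measure_univ]

lemma measurePreserving_comp_pi_prod (m : κ → Measure S) [∀ k, IsProbabilityMeasure (m k)]
    {f : ι → κ} (hf : Function.Injective f) {a : κ} (ha : ∀ i, f i ≠ a) :
    MeasurePreserving (fun X : κ → S => ((fun i => X (f i)), X a)) (Measure.pi m)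
      ((Measure.pi fun i => m (f i)).prod (m a)) := by
  classical
  have hind : iIndepFun (fun k (X : κ → S) => X k) (Measure.pi m) :=
    iIndepFun_pi (X := fun _ x => x) fun k => aemeasurable_id
  have h1 := hind.indepFun_finset (Finset.univ.image f) {a}
    (by simpa [Finset.disjoint_singleton_right] using ha) fun k => measurable_pi_apply k
  have h2 : IndepFun (fun (X : κ → S) i => X (f i)) (fun X : κ → S => X a) (Measure.pi m) :=
    h1.comp (φ := fun (Y : (Finset.univ.image f) → S) (i : ι) => Y ⟨f i, by simp⟩)
      (ψ := fun Y : ({a} : Finset κ) → S => Y ⟨a, by simp⟩)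
      (measurable_pi_lambda _ fun i => measurable_pi_apply _) (measurable_pi_apply _)
  refine ⟨(measurable_comp_index f).prodMk (measurable_pi_apply a), ?_⟩
  rw [(indepFun_iff_map_prod_eq_prod_map_map (measurable_comp_index f).aemeasurable
    (measurable_pi_apply a).aemeasurable).1 h2, (measurePreserving_comp_pi m hf).map_eq,
    (measurePreserving_eval m a).map_eq]

/-- The replica trick: an average under `m (f i)` equals evaluation at an extra independent
coordinate `a i` with the same law. Each `i` is treated separately, so `a` need not be injective and
several indices may share one fresh coordinate. -/
lemma integral_mul_sum_sub (m : κ → Measure S) [∀ k, IsProbabilityMeasure (m k)] {f a : ι → κ}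
    (hf : Function.Injective f) (ha : ∀ i j, f i ≠ a j) (hm : ∀ i, m (a i) = m (f i))
    {B : (ι → S) → ℝ} (hB : Measurable B) {H : (ι → S) → S → ℝ}
    (hH : Measurable fun p : (ι → S) × S => H p.1 p.2)
    (hfi : ∀ i, Integrable (fun X : κ → S =>
      B (fun i => X (f i)) * H (fun i => X (f i)) (X (f i))) (Measure.pi m))
    (hai : ∀ i, Integrable (fun X : κ → S =>
      B (fun i => X (f i)) * H (fun i => X (f i)) (X (a i))) (Measure.pi m)) :
    ∫ X, B X * ∑ i, (H X (X i) - ∫ y, H X y ∂(m (f i))) ∂(Measure.pi fun i => m (f i)) =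
      ∑ i, ((∫ X, B (fun i => X (f i)) * H (fun i => X (f i)) (X (f i)) ∂(Measure.pi m)) -
        ∫ X, B (fun i => X (f i)) * H (fun i => X (f i)) (X (a i)) ∂(Measure.pi m)) := by
  have hp := measurePreserving_comp_pi m hf
  have hpa := fun i => measurePreserving_comp_pi_prod m hf (a := a i) fun j => ha j i
  have h1m : ∀ i, Measurable fun X : ι → S => B X * H X (X i) := fun i =>
    hB.mul (hH.comp (measurable_id.prodMk (measurable_pi_apply i)))
  have h2m : Measurable fun p : (ι → S) × S => B p.1 * H p.1 p.2 :=
    (hB.comp measurable_fst).mul hH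
  have hfi' : ∀ i, Integrable (fun X => B X * H X (X i)) (Measure.pi fun i => m (f i)) := fun i =>
    (hp.integrable_comp (h1m i).aestronglyMeasurable).1 (hfi i)
  have hai' : ∀ i, Integrable (fun p : (ι → S) × S => B p.1 * H p.1 p.2)
      ((Measure.pi fun i => m (f i)).prod (m (a i))) := fun i =>
    ((hpa i).integrable_comp h2m.aestronglyMeasurable).1 (hai i)
  have hai'' : ∀ i, Integrable (fun X => B X * ∫ y, H X y ∂(m (f i)))
      (Measure.pi fun i => m (f i)) := fun i => by
    have := (hai' i).integral_prod_left
    simpa only [integral_const_mul, hm i] using this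
  have e1 : ∀ i, ∫ X, B (fun i => X (f i)) * H (fun i => X (f i)) (X (f i)) ∂(Measure.pi m) =
      ∫ X, B X * H X (X i) ∂(Measure.pi fun i => m (f i)) := fun i => by
    rw [← hp.map_eq, integral_map hp.measurable.aemeasurable (h1m i).aestronglyMeasurable]
  have e2 : ∀ i, ∫ X, B (fun i => X (f i)) * H (fun i => X (f i)) (X (a i)) ∂(Measure.pi m) =
      ∫ X, B X * ∫ y, H X y ∂(m (f i)) ∂(Measure.pi fun i => m (f i)) := fun i => by
    have h3 := integral_prod _ (hai' i)
    rw [← (hpa i).map_eq, integral_map (hpa i).measurable.aemeasurable h2m.aestronglyMeasurable]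
      at h3
    rw [h3]
    simp only [integral_const_mul, hm i]
  simp only [e1, e2, Finset.mul_sum, mul_sub]
  refine (integral_finsetSum (f := fun i X => B X * H X (X i) - B X * ∫ y, H X y ∂(m (f i))) _
    fun i _ => (hfi' i).sub (hai'' i)).trans ?_
  exact Finset.sum_congr rfl fun i _ => integral_sub (hfi' i) (hai'' i)

lemma lintegral_pi_prod (P : ι → Measure S) [∀ i, IsProbabilityMeasure (P i)]
    {g : ι → S → ℝ≥0∞} (hg : ∀ i, Measurable (g i)) :
    ∫⁻ X, ∏ i, g i (X i) ∂(Measure.pi P) = ∏ i, ∫⁻ x, g i x ∂(P i) := by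
  have hind : iIndepFun (fun i (X : ι → S) => g i (X i)) (Measure.pi P) :=
    iIndepFun_pi fun i => (hg i).aemeasurable
  have := lintegral_prod_eq_prod_lintegral_of_indepFun Finset.univ _ hind
    fun i => (hg i).comp (measurable_pi_apply i)
  rw [this]
  refine Finset.prod_congr rfl fun i _ => ?_
  rw [← (measurePreserving_eval P i).map_eq, lintegral_map (hg i) (measurable_pi_apply i)]

lemma pi_withDensity (P : ι → Measure S) [∀ i, IsProbabilityMeasure (P i)]
    {g : ι → S → ℝ≥0∞} (hg : ∀ i, Measurable (g i)) [∀ i, SigmaFinite ((P i).withDensity (g i))] :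
    Measure.pi (fun i => (P i).withDensity (g i)) =
      (Measure.pi P).withDensity fun X => ∏ i, g i (X i) := by
  refine Measure.pi_eq fun s hs => ?_
  rw [withDensity_apply _ (MeasurableSet.univ_pi hs),
    ← lintegral_indicator (MeasurableSet.univ_pi hs)]
  have h1 : (univ.pi s).indicator (fun X : ι → S => ∏ i, g i (X i)) =
      fun X => ∏ i, (s i).indicator (g i) (X i) := by
    funext X
    by_cases hX : X ∈ univ.pi s
    · rw [indicator_of_mem hX]
      exact Finset.prod_congr rfl fun i _ => (indicator_of_mem (hX i trivial) _).symm
    · rw [indicator_of_notMem hX]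
      obtain ⟨i, hi⟩ : ∃ i, X i ∉ s i := by simpa using hX
      exact (Finset.prod_eq_zero (Finset.mem_univ i) (indicator_of_notMem hi _)).symm
  rw [h1, lintegral_pi_prod P fun i => (hg i).indicator (hs i)]
  refine Finset.prod_congr rfl fun i _ => ?_
  rw [withDensity_apply _ (hs i), lintegral_indicator (hs i)]

lemma pi_tilted (P : ι → Measure S) [∀ i, IsProbabilityMeasure (P i)] {e : S → ℝ}
    (he : Measurable e) :
    Measure.pi (fun i => (P i).tilted e) =
      (Measure.pi P).withDensity fun X => ENNReal.ofReal (gibbsWeight P e X) := by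
  have hg : ∀ i, Measurable fun x => ENNReal.ofReal (gibbs (P i) e x) := fun i =>
    (measurable_gibbs he).ennreal_ofReal
  have hσ : ∀ i, SigmaFinite ((P i).withDensity fun x => ENNReal.ofReal (gibbs (P i) e x)) :=
    fun i => inferInstanceAs (SigmaFinite ((P i).tilted e))
  have := pi_withDensity P hg
  simp only [gibbsWeight, ENNReal.ofReal_prod_of_nonneg fun i _ => gibbs_nonneg _ _ _]
  exact this

/-- No integrability is asked of `B` or of `exp e`, so the identity can be used for every `ω`. -/
lemma integral_pi_tilted (P : ι → Measure S) [∀ i, IsProbabilityMeasure (P i)] {e : S → ℝ}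
    (he : Measurable e) (B : (ι → S) → ℝ) :
    ∫ X, B X ∂(Measure.pi fun i => (P i).tilted e) =
      ∫ X, B X * gibbsWeight P e X ∂(Measure.pi P) := by
  have hw : Measurable (gibbsWeight P e) :=
    Finset.measurable_fun_prod _ fun i _ => (measurable_gibbs he).comp (measurable_pi_apply i)
  rw [pi_tilted P he, integral_withDensity_eq_integral_toReal_smul hw.ennreal_ofReal
    (.of_forall fun _ => ENNReal.ofReal_lt_top)]
  simp only [ENNReal.toReal_ofReal (gibbsWeight_nonneg _ _ _), smul_eq_mul, mul_comm]

lemma integrable_pi_tilted (P : ι → Measure S) [∀ i, IsProbabilityMeasure (P i)] {e : S → ℝ}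
    (he : Measurable e) {B : (ι → S) → ℝ}
    (hB : Integrable (fun X => B X * gibbsWeight P e X) (Measure.pi P)) :
    Integrable B (Measure.pi fun i => (P i).tilted e) := by
  have hw : Measurable (gibbsWeight P e) :=
    Finset.measurable_fun_prod _ fun i _ => (measurable_gibbs he).comp (measurable_pi_apply i)
  rw [pi_tilted P he, integrable_withDensity_iff_integrable_smul' hw.ennreal_ofReal
    (.of_forall fun _ => ENNReal.ofReal_lt_top)]
  simpa only [ENNReal.toReal_ofReal (gibbsWeight_nonneg _ _ _), smul_eq_mul, mul_comm] using hB

lemma integral_tilted_eq_gibbsAvg (P : Measure S) (e f : S → ℝ) :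
    ∫ y, f y ∂(P.tilted e) = gibbsAvg P e f := by
  rw [integral_tilted, gibbsAvg]
  simp only [gibbs, smul_eq_mul, mul_comm]

end ProductMeasure

/-! ### Replicas under the annealed mean -/

/-- The annealed mean of `B` times the field at the `j`-th point. -/
def fieldMean {S Ω κ : Type*} [MeasurableSpace S] [MeasurableSpace Ω] [Fintype κ]
    (μ : Measure Ω) (U : S → Ω → ℝ) (P : κ → Measure S) (β : ℝ) (B : (κ → S) → ℝ) (j : κ) : ℝ :=
  ∫ ω, ∫ X, B X * U (X j) ω * gibbsWeight P (fun y => β * U y ω) X ∂(Measure.pi P) ∂μ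

namespace IsGaussianField

variable {S Ω ι κ : Type*} [TopologicalSpace S] [MeasurableSpace S] [MeasurableSpace Ω]
  [Fintype ι] [Fintype κ] {μ : Measure Ω} {U : S → Ω → ℝ} {K : S → S → ℝ}
  {v : ℝ≥0} {P : κ → Measure S}

lemma integrable_mul_cov (h : IsGaussianField μ U K v) [SecondCountableTopology S]
    [OpensMeasurableSpace S] {B : (κ → S) → ℝ} (hB : Integrable B (Measure.pi P)) (i j : κ) :
    Integrable (fun X => B X * K (X i) (X j)) (Measure.pi P) := by
  have hK : Measurable fun X : κ → S => K (X i) (X j) := h.continuous.measurable.comp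
    (f := fun X : κ → S => (X i, X j)) ((measurable_pi_apply i).prodMk (measurable_pi_apply j))
  exact hB.mul_bdd (c := v) hK.aestronglyMeasurable (.of_forall fun X => h.abs_cov_le _ _)

variable [IsProbabilityMeasure μ]

lemma ae_isProbabilityMeasure_tilted (h : IsGaussianField μ U K v) (P : κ → Measure S)
    [∀ k, IsProbabilityMeasure (P k)] (β : ℝ) :
    ∀ᵐ ω ∂μ, ∀ k, IsProbabilityMeasure ((P k).tilted fun y => β * U y ω) := by
  filter_upwards [h.ae_integrable_exp_abs P] with ω hω k
  exact isProbabilityMeasure_tilted (integrable_exp_mul (h.measurable_section ω) (hω k) β)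

variable [∀ k, IsProbabilityMeasure (P k)]

lemma integrable_mul_field_weight (h : IsGaussianField μ U K v) {B : (κ → S) → ℝ}
    (hB : Integrable B (Measure.pi P)) (β : ℝ) (j : κ) :
    Integrable (fun p : Ω × (κ → S) =>
      B p.2 * U (p.2 j) p.1 * gibbsWeight P (fun y => β * U y p.1) p.2)
      (μ.prod (Measure.pi P)) := by
  have hU : Measurable fun p : Ω × (κ → S) => U (p.2 j) p.1 :=
    h.measurable.comp (f := fun p : Ω × (κ → S) => (p.2 j, p.1))
      (((measurable_pi_apply j).comp measurable_snd).prodMk measurable_fst)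
  refine ((h.integrable_mul_dominant hB.norm
    (6 * Fintype.card κ * (|β| + 1))).mul_const 2).mono'
    ((hB.1.comp_snd.mul hU.aestronglyMeasurable).mul
      (h.measurable_weight β).aestronglyMeasurable) ?_
  filter_upwards [Measure.quasiMeasurePreserving_fst.ae (h.ae_integrable_exp_abs P)
    (μa := μ.prod (Measure.pi P))] with p hp
  rw [norm_mul, norm_mul, mul_assoc, mul_assoc]
  refine mul_le_mul_of_nonneg_left ?_ (norm_nonneg _)
  rw [mul_comm _ (2 : ℝ)]
  refine le_trans ?_ (gibbsWeight_mul_le_dominant (h.measurable_section p.1) hp le_rfl p.2 j)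
  rw [mul_comm, Real.norm_of_nonneg (gibbsWeight_nonneg _ _ _), Real.norm_eq_abs]
  exact mul_le_mul_of_nonneg_left (le_add_of_nonneg_right (integral_nonneg fun y =>
    mul_nonneg (abs_nonneg _) (gibbs_nonneg _ _ _))) (gibbsWeight_nonneg _ _ _)

/-- The replica trick averaged over the noise. It is used with `H` equal to the field itself, after
differentiating, and with `H` equal to a row of the covariance, after integrating by parts. -/
lemma integral_weight_mul_sum_sub (h : IsGaussianField μ U K v) {f a : ι → κ}
    (hf : Function.Injective f) (ha : ∀ i j, f i ≠ a j) (hP : ∀ i, P (a i) = P (f i)) (β : ℝ)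
    {B : (ι → S) → ℝ} (hB : Measurable B) {H : Ω → (ι → S) → S → ℝ}
    (hH : ∀ ω, Measurable fun p : (ι → S) × S => H ω p.1 p.2)
    (hfi : ∀ i, Integrable (fun p : Ω × (κ → S) => B (fun i => p.2 (f i)) *
      H p.1 (fun i => p.2 (f i)) (p.2 (f i)) * gibbsWeight P (fun y => β * U y p.1) p.2)
      (μ.prod (Measure.pi P)))
    (hai : ∀ i, Integrable (fun p : Ω × (κ → S) => B (fun i => p.2 (f i)) *
      H p.1 (fun i => p.2 (f i)) (p.2 (a i)) * gibbsWeight P (fun y => β * U y p.1) p.2)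
      (μ.prod (Measure.pi P))) :
    ∫ ω, ∫ X, B X * (gibbsWeight (fun i => P (f i)) (fun y => β * U y ω) X *
        ∑ i, (H ω X (X i) - gibbsAvg (P (f i)) (fun y => β * U y ω) (H ω X)))
        ∂(Measure.pi fun i => P (f i)) ∂μ =
      ∑ i, ((∫ ω, ∫ X, B (fun i => X (f i)) * H ω (fun i => X (f i)) (X (f i)) *
          gibbsWeight P (fun y => β * U y ω) X ∂(Measure.pi P) ∂μ) -
        ∫ ω, ∫ X, B (fun i => X (f i)) * H ω (fun i => X (f i)) (X (a i)) *
          gibbsWeight P (fun y => β * U y ω) X ∂(Measure.pi P) ∂μ) := by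
  have e1 := fun i => integral_sub (hfi i).integral_prod_left (hai i).integral_prod_left
  simp only [← e1]
  refine Eq.trans ?_ (integral_finsetSum _ fun i _ =>
    (hfi i).integral_prod_left.sub (hai i).integral_prod_left)
  refine integral_congr_ae ?_
  filter_upwards [h.ae_isProbabilityMeasure_tilted P β, ae_all_iff.2 fun i => (hfi i).prod_right_ae,
    ae_all_iff.2 fun i => (hai i).prod_right_ae] with ω hω h1 h2
  have he : Measurable fun y => β * U y ω := (h.measurable_section ω).const_mul β
  have key := integral_mul_sum_sub (fun k => (P k).tilted fun y => β * U y ω) hf ha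
    (fun i => by rw [hP i]) hB (hH ω) (fun i => integrable_pi_tilted P he (h1 i))
    (fun i => integrable_pi_tilted P he (h2 i))
  simp only [integral_pi_tilted P he, integral_pi_tilted (fun i => P (f i)) he,
    integral_tilted_eq_gibbsAvg] at key
  refine Eq.trans ?_ key
  refine integral_congr_ae (.of_forall fun X => ?_)
  simp only
  ring

theorem hasDerivAt_tiltedMean (h : IsGaussianField μ U K v) {f a : ι → κ}
    (hf : Function.Injective f) (ha : ∀ i j, f i ≠ a j) (hP : ∀ i, P (a i) = P (f i)) (β : ℝ)
    {B : (ι → S) → ℝ} (hB : Measurable B) (hBi : Integrable B (Measure.pi fun i => P (f i))) :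
    HasDerivAt (fun β => tiltedMean μ U (fun i => P (f i)) β B)
      (∑ i, (fieldMean μ U P β (fun X => B fun i => X (f i)) (f i) -
        fieldMean μ U P β (fun X => B fun i => X (f i)) (a i))) β := by
  obtain ⟨h1, h2⟩ := h.hasDerivAt_tiltedMean_aux hBi β
  refine h2.congr_deriv ?_
  have hBκ : Integrable (fun X : κ → S => B fun i => X (f i)) (Measure.pi P) :=
    (measurePreserving_comp_pi P hf).integrable_comp_of_integrable hBi
  rw [integral_prod _ h1]
  exact h.integral_weight_mul_sum_sub hf ha hP β hB (H := fun ω _ y => U y ω)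
    (fun ω => (h.measurable_section ω).comp measurable_snd)
    (fun i => h.integrable_mul_field_weight hBκ β (f i))
    (fun i => h.integrable_mul_field_weight hBκ β (a i))

theorem fieldMean_eq (h : IsGaussianField μ U K v) [SecondCountableTopology S]
    [OpensMeasurableSpace S] {f a : ι → κ}
    (hf : Function.Injective f) (ha : ∀ i j, f i ≠ a j) (hP : ∀ i, P (a i) = P (f i)) (β : ℝ)
    {B : (ι → S) → ℝ} (hB : Measurable B) (hBi : Integrable B (Measure.pi fun i => P (f i)))
    (j : ι) :
    fieldMean μ U (fun i => P (f i)) β B j =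
      β * ∑ k, (tiltedMean μ U P β (fun X => B (fun i => X (f i)) * K (X (f j)) (X (f k))) -
        tiltedMean μ U P β (fun X => B (fun i => X (f i)) * K (X (f j)) (X (a k)))) := by
  have hBκ : Integrable (fun X : κ → S => B fun i => X (f i)) (Measure.pi P) :=
    (measurePreserving_comp_pi P hf).integrable_comp_of_integrable hBi
  have hK : Measurable fun p : (ι → S) × S => K (p.1 j) p.2 := h.continuous.measurable.comp
    (f := fun p : (ι → S) × S => (p.1 j, p.2))
    (((measurable_pi_apply j).comp measurable_fst).prodMk measurable_snd)
  have key := h.integral_weight_mul_sum_sub hf ha hP β hB (H := fun _ X y => K (X j) y)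
    (fun _ => hK) (fun i => h.integrable_mul_weight (h.integrable_mul_cov hBκ (f j) (f i)) β)
    (fun i => h.integrable_mul_weight (h.integrable_mul_cov hBκ (f j) (a i)) β)
  simp only [tiltedMean]
  -- Integration by parts takes place in `ω` with the points frozen, hence the exchange of integrals
  -- here and again on the other side.
  rw [← key, fieldMean, integral_integral_swap (h.integrable_mul_field_weight hBi β j)]
  have hKm : Measurable fun p : (Ω × (ι → S)) × S => K (p.1.2 j) p.2 :=
    hK.comp (f := fun p : (Ω × (ι → S)) × S => (p.1.2, p.2))
      ((measurable_snd.comp measurable_fst).prodMk measurable_snd)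
  have hsum : Measurable fun p : Ω × (ι → S) => ∑ i, (K (p.2 j) (p.2 i) -
      gibbsAvg (P (f i)) (fun y => β * U y p.1) (K (p.2 j))) := by
    refine Finset.measurable_fun_sum _ fun i _ => Measurable.sub ?_ ?_
    · exact h.continuous.measurable.comp (f := fun p : Ω × (ι → S) => (p.2 j, p.2 i))
        (((measurable_pi_apply j).comp measurable_snd).prodMk
          ((measurable_pi_apply i).comp measurable_snd))
    · exact measurable_gibbsAvg (e := fun (p : Ω × (ι → S)) y => β * U y p.1)
        (h.measurable_energy_fst β) hKm
  have hInt : Integrable (fun p : Ω × (ι → S) =>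
      B p.2 * (gibbsWeight (fun i => P (f i)) (fun y => β * U y p.1) p.2 *
        ∑ i, (K (p.2 j) (p.2 i) - gibbsAvg (P (f i)) (fun y => β * U y p.1) (K (p.2 j)))))
      (μ.prod (Measure.pi fun i => P (f i))) := by
    have := (h.integrable_mul_weight hBi β).mul_bdd (c := Fintype.card ι * (2 * v))
      hsum.aestronglyMeasurable (.of_forall fun p =>
        h.abs_sum_cov_sub_le (P := fun i => P (f i)) _ _ _)
    simpa only [mul_assoc] using this
  have hswap := integral_integral_swap (f := fun ω X =>
      B X * (gibbsWeight (fun i => P (f i)) (fun y => β * U y ω) X *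
        ∑ i, (K (X j) (X i) - gibbsAvg (P (f i)) (fun y => β * U y ω) (K (X j))))) hInt
  rw [hswap, ← integral_const_mul]
  refine integral_congr_ae (.of_forall fun X => ?_)
  simp only [mul_assoc]
  rw [integral_const_mul, integral_const_mul,
    h.integral_mul_weight (P := fun i => P (f i)) β X j]
  ring

/-- Given the noise, the points are independent with probability laws, so unobserved coordinates
integrate to one. -/
lemma tiltedMean_comp (h : IsGaussianField μ U K v) {f : ι → κ} (hf : Function.Injective f) (β : ℝ)
    {B : (ι → S) → ℝ} (hB : Measurable B) :
    tiltedMean μ U P β (fun X => B fun i => X (f i)) =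
      tiltedMean μ U (fun i => P (f i)) β B := by
  refine integral_congr_ae ?_
  filter_upwards [h.ae_isProbabilityMeasure_tilted P β] with ω hω
  have he : Measurable fun y => β * U y ω := (h.measurable_section ω).const_mul β
  have hp := measurePreserving_comp_pi (fun k => (P k).tilted fun y => β * U y ω) hf
  rw [← integral_pi_tilted P he, ← integral_pi_tilted (fun i => P (f i)) he, ← hp.map_eq,
    integral_map hp.measurable.aemeasurable hB.aestronglyMeasurable]

end IsGaussianField

/-! ### Layers of replicas and the derivative estimate -/

/-- The inclusion of `n` layers of indices into `n + 1` layers. -/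
def layerUp {n J : ℕ} (i : Fin n × Fin J) : Fin (n + 1) × Fin J := (i.1.castSucc, i.2)

/-- The index in the new layer that has the same label as `i`. -/
def layerNew {n J : ℕ} (i : Fin n × Fin J) : Fin (n + 1) × Fin J := (Fin.last n, i.2)

lemma layerUp_injective {n J : ℕ} : Function.Injective (layerUp (n := n) (J := J)) :=
  fun _ _ h => Prod.ext (Fin.castSucc_injective n (congrArg Prod.fst h)) (congrArg Prod.snd h :)

lemma layerUp_ne_layerNew {n J : ℕ} (i j : Fin n × Fin J) : layerUp i ≠ layerNew j :=
  fun h => (Fin.castSucc_lt_last i.1).ne (congrArg Prod.fst h)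

/-- `Q` evaluated at the paths `X ∘ z`, times the `r`-th power of `K (X a) (X b)`. -/
def pairFun {S κ : Type*} {J : ℕ} (K : S → S → ℝ) (Q : (Fin J → S) → ℝ) (r : ℝ) (z : Fin J → κ)
    (a b : κ) (X : κ → S) : ℝ :=
  Q (fun j => X (z j)) * K (X a) (X b) ^ r

/-- Each of the two sums contains the value `V` at its own diagonal index, so `V` disappears from
the difference however large it is. -/
lemma abs_sum_sub_le_of_diag {κ : Type*} [Fintype κ] [DecidableEq κ] {t t' : κ → ℝ} {M V : ℝ}
    {a a' : κ} (ha : t a = V) (ha' : t' a' = V) (hM : 0 ≤ M) (ht : ∀ k, k ≠ a → |t k| ≤ M)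
    (ht' : ∀ k, k ≠ a' → |t' k| ≤ M) :
    |∑ k, (t k - t' k)| ≤ 2 * Fintype.card κ * M := by
  have key : ∀ (t : κ → ℝ) (a : κ), t a = V → (∀ k, k ≠ a → |t k| ≤ M) →
      |∑ k, t k - V| ≤ Fintype.card κ * M := fun t a ha ht => by
    rw [← Finset.add_sum_erase _ _ (Finset.mem_univ a), ha, add_sub_cancel_left]
    refine (Finset.abs_sum_le_sum_abs _ _).trans ((Finset.sum_le_card_nsmul _ _ M fun k hk =>
      ht k (Finset.ne_of_mem_erase hk)).trans ?_)
    rw [nsmul_eq_mul]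
    exact mul_le_mul_of_nonneg_right (by exact_mod_cast Finset.card_le_univ _) hM
  have h1 := key t a ha ht
  have h2 := key t' a' ha' ht'
  rw [Finset.sum_sub_distrib]
  rw [abs_le] at *
  constructor <;> linarith [h1.1, h1.2, h2.1, h2.2]

lemma rpow_mul_le_add {x y r : ℝ} (hx : 0 ≤ x) (hy : 0 ≤ y) (hr : 0 ≤ r) :
    x ^ r * y ≤ x ^ (r + 1) + y ^ (r + 1) := by
  have key : ∀ z : ℝ, 0 ≤ z → z ^ (r + 1) = z ^ r * z := fun z hz => by
    rw [Real.rpow_add_of_nonneg hz hr zero_le_one, Real.rpow_one]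
  rw [key x hx, key y hy]
  rcases le_total x y with h | h
  · have := mul_le_mul_of_nonneg_right (Real.rpow_le_rpow hx h hr) hy
    have h0 : 0 ≤ x ^ r * x := by positivity
    linarith
  · have := mul_le_mul_of_nonneg_left h (Real.rpow_nonneg hx r)
    have h0 : 0 ≤ y ^ r * y := by positivity
    linarith

lemma tiltedMean_nonneg {S Ω κ : Type*} [MeasurableSpace S] [MeasurableSpace Ω] [Fintype κ]
    {μ : Measure Ω} {U : S → Ω → ℝ} {P : κ → Measure S} {B : (κ → S) → ℝ} (hB : ∀ X, 0 ≤ B X) (β : ℝ) :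
    0 ≤ tiltedMean μ U P β B :=
  integral_nonneg fun _ => integral_nonneg fun X => mul_nonneg (hB X) (gibbsWeight_nonneg _ _ _)

namespace IsGaussianField

section PairFun

variable {S Ω κ : Type*} [TopologicalSpace S] [MeasurableSpace S] [MeasurableSpace Ω]
  {μ : Measure Ω} {U : S → Ω → ℝ} {K : S → S → ℝ} {v : ℝ≥0} {P : κ → Measure S}
  {J : ℕ} {Q : (Fin J → S) → ℝ} [SecondCountableTopology S] [OpensMeasurableSpace S]

lemma measurable_pairFun (h : IsGaussianField μ U K v) (hQ : Measurable Q) (r : ℝ) (z : Fin J → κ)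
    (a b : κ) : Measurable (pairFun K Q r z a b) := by
  have hK : Measurable fun X : κ → S => K (X a) (X b) := h.continuous.measurable.comp
    (f := fun X : κ → S => (X a, X b)) ((measurable_pi_apply a).prodMk (measurable_pi_apply b))
  exact (hQ.comp (measurable_comp_index z)).mul (hK.pow_const r)

variable [Fintype κ] [∀ k, IsProbabilityMeasure (P k)]

lemma integrable_pairFun (h : IsGaussianField μ U K v) (hK0 : ∀ x y, 0 ≤ K x y) {z : Fin J → κ}
    (hz : Function.Injective z) (hQi : Integrable Q (Measure.pi fun j => P (z j)))
    {r : ℝ} (hr : 0 ≤ r) (a b : κ) :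
    Integrable (pairFun K Q r z a b) (Measure.pi P) := by
  have hK : Measurable fun X : κ → S => K (X a) (X b) := h.continuous.measurable.comp
    (f := fun X : κ → S => (X a, X b)) ((measurable_pi_apply a).prodMk (measurable_pi_apply b))
  refine ((measurePreserving_comp_pi P hz).integrable_comp_of_integrable hQi).mul_bdd
    (c := (v : ℝ) ^ r) (hK.pow_const r).aestronglyMeasurable (.of_forall fun X => ?_)
  rw [Real.norm_of_nonneg (Real.rpow_nonneg (hK0 _ _) _)]
  exact Real.rpow_le_rpow (hK0 _ _) ((le_abs_self _).trans (h.abs_cov_le _ _)) hr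

end PairFun

section TiltedMean

variable {S Ω κ : Type*} [TopologicalSpace S] [MeasurableSpace S] [MeasurableSpace Ω]
  [Fintype κ] {μ : Measure Ω} [IsProbabilityMeasure μ] {U : S → Ω → ℝ} {K : S → S → ℝ}
  {v : ℝ≥0} {P : κ → Measure S} [∀ k, IsProbabilityMeasure (P k)]

lemma tiltedMean_eq (h : IsGaussianField μ U K v) {B : (κ → S) → ℝ}
    (hB : Integrable B (Measure.pi P)) (β : ℝ) :
    tiltedMean μ U P β B = ∫ p : Ω × (κ → S), B p.2 * gibbsWeight P (fun y => β * U y p.1) p.2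
      ∂(μ.prod (Measure.pi P)) :=
  (integral_prod _ (h.integrable_mul_weight hB β)).symm

lemma tiltedMean_mono (h : IsGaussianField μ U K v) {B B' : (κ → S) → ℝ}
    (hB : Integrable B (Measure.pi P)) (hB' : Integrable B' (Measure.pi P)) (hle : ∀ X, B X ≤ B' X)
    (β : ℝ) : tiltedMean μ U P β B ≤ tiltedMean μ U P β B' := by
  rw [h.tiltedMean_eq hB, h.tiltedMean_eq hB']
  exact integral_mono (h.integrable_mul_weight hB β) (h.integrable_mul_weight hB' β) fun p =>
    mul_le_mul_of_nonneg_right (hle p.2) (gibbsWeight_nonneg _ _ _)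

lemma abs_tiltedMean_le (h : IsGaussianField μ U K v) {B B' : (κ → S) → ℝ}
    (hB : Integrable B (Measure.pi P)) (hB' : Integrable B' (Measure.pi P))
    (hle : ∀ X, |B X| ≤ B' X) (β : ℝ) : |tiltedMean μ U P β B| ≤ tiltedMean μ U P β B' := by
  rw [h.tiltedMean_eq hB, h.tiltedMean_eq hB']
  refine (abs_integral_le_integral_abs).trans (integral_mono
    (h.integrable_mul_weight hB β).abs (h.integrable_mul_weight hB' β) fun p => ?_)
  simp only [abs_mul, abs_of_nonneg (gibbsWeight_nonneg _ _ _)]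
  exact mul_le_mul_of_nonneg_right (hle p.2) (gibbsWeight_nonneg _ _ _)

lemma tiltedMean_add (h : IsGaussianField μ U K v) {B B' : (κ → S) → ℝ}
    (hB : Integrable B (Measure.pi P)) (hB' : Integrable B' (Measure.pi P)) (β : ℝ) :
    tiltedMean μ U P β (fun X => B X + B' X) = tiltedMean μ U P β B + tiltedMean μ U P β B' := by
  rw [h.tiltedMean_eq hB, h.tiltedMean_eq hB', h.tiltedMean_eq (B := fun X => B X + B' X) (hB.add hB'),
    ← integral_add (h.integrable_mul_weight hB β) (h.integrable_mul_weight hB' β)]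
  simp only [add_mul]

lemma continuous_tiltedMean (h : IsGaussianField μ U K v) {B : (κ → S) → ℝ}
    (hB : Integrable B (Measure.pi P)) : Continuous fun β => tiltedMean μ U P β B :=
  continuous_iff_continuousAt.2 fun β => (h.hasDerivAt_tiltedMean_aux hB β).2.continuousAt

end TiltedMean

end IsGaussianField

/-- The sum of the annealed means of `Q[X₀] K(X_a, X_b) ^ r` over distinct pairs of indices. -/
def pairSum {S Ω : Type*} {J : ℕ} [MeasurableSpace S] [MeasurableSpace Ω] (μ : Measure Ω)
    (U : S → Ω → ℝ) (K : S → S → ℝ) (P : Fin J → Measure S) (r : ℝ) (Q : (Fin J → S) → ℝ)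
    (β : ℝ) : ℝ :=
  ∑ a : Fin 3 × Fin J, ∑ b : Fin 3 × Fin J, if a ≠ b then
    tiltedMean μ U (fun i : Fin 3 × Fin J => P i.2) β (pairFun K Q r (fun j => (0, j)) a b) else 0

/-- Layer `0` carries `Q`, and a pair of indices touches at most two further layers: this is why
three layers close the estimate. -/
lemma exists_layers (c d : Fin 5) : ∃ x y : Fin 5, x ≠ 0 ∧ y ≠ 0 ∧ x ≠ y ∧
    (c = 0 ∨ c = x ∨ c = y) ∧ (d = 0 ∨ d = x ∨ d = y) := by
  revert c d
  decide

lemma exists_layer_relabelling {J : ℕ} (c d : Fin 5 × Fin J) :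
    ∃ (f : Fin 3 × Fin J → Fin 5 × Fin J) (c' d' : Fin 3 × Fin J), Function.Injective f ∧
      (∀ i, (f i).2 = i.2) ∧ (∀ j, f (0, j) = (0, j)) ∧ f c' = c ∧ f d' = d := by
  obtain ⟨x, y, hx, hy, hxy, hc, hd⟩ := exists_layers c.1 d.1
  have hinj : Function.Injective (![0, x, y] : Fin 3 → Fin 5) := by
    intro i j hij
    fin_cases i <;> fin_cases j <;> simp_all [eq_comm]
  have hmem : ∀ w : Fin 5, (w = 0 ∨ w = x ∨ w = y) → ∃ i : Fin 3, (![0, x, y] : Fin 3 → Fin 5) i = w :=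
    fun w hw => by
      rcases hw with rfl | rfl | rfl
      exacts [⟨0, rfl⟩, ⟨1, rfl⟩, ⟨2, rfl⟩]
  obtain ⟨i, hi⟩ := hmem _ hc
  obtain ⟨j, hj⟩ := hmem _ hd
  refine ⟨fun i => ((![0, x, y] : Fin 3 → Fin 5) i.1, i.2), (i, c.2), (j, d.2), ?_, fun _ => rfl,
    fun _ => rfl, Prod.ext hi rfl, Prod.ext hj rfl⟩
  intro p q hpq
  exact Prod.ext (hinj (congrArg Prod.fst hpq)) (congrArg Prod.snd hpq :)

namespace IsGaussianField

variable {S Ω : Type*} [TopologicalSpace S] [MeasurableSpace S] [MeasurableSpace Ω]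
  {μ : Measure Ω} [IsProbabilityMeasure μ] {U : S → Ω → ℝ} {K : S → S → ℝ}
  {v : ℝ≥0} {J : ℕ} {P : Fin J → Measure S} [∀ k, IsProbabilityMeasure (P k)]
  {Q : (Fin J → S) → ℝ} [SecondCountableTopology S] [OpensMeasurableSpace S]

/-- Layers are exchangeable, so the three that matter can be renamed `0, 1, 2` with layer `0` fixed;
the result is then one of the nonnegative terms of the sum. -/
lemma tiltedMean_pairFun_le_pairSum (h : IsGaussianField μ U K v) (hK0 : ∀ x y, 0 ≤ K x y)
    (hQ : Measurable Q) (hQ0 : ∀ X, 0 ≤ Q X) (r : ℝ) {c d : Fin 5 × Fin J} (hcd : c ≠ d) (β : ℝ) :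
    tiltedMean μ U (fun i : Fin 5 × Fin J => P i.2) β (pairFun K Q r (fun j => (0, j)) c d) ≤
      pairSum μ U K P r Q β := by
  obtain ⟨f, c', d', hf, hf2, hf0, rfl, rfl⟩ := exists_layer_relabelling c d
  have h1 := h.tiltedMean_comp (P := fun i : Fin 5 × Fin J => P i.2) hf β
    (h.measurable_pairFun hQ r (fun j => ((0 : Fin 3), j)) c' d')
  simp only [hf2] at h1
  have h2 : pairFun K Q r (fun j => ((0 : Fin 5), j)) (f c') (f d') = fun X =>
      pairFun K Q r (fun j => ((0 : Fin 3), j)) c' d' fun i => X (f i) := by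
    funext X
    simp only [pairFun, hf0]
  have hne : c' ≠ d' := fun hh => hcd (by rw [hh])
  have h0 : ∀ a b : Fin 3 × Fin J, 0 ≤ if a ≠ b then
      tiltedMean μ U (fun i : Fin 3 × Fin J => P i.2) β (pairFun K Q r (fun j => (0, j)) a b)
      else 0 := fun a b => by
    split_ifs
    · exact tiltedMean_nonneg (fun X => mul_nonneg (hQ0 _) (Real.rpow_nonneg (hK0 _ _) _)) β
    · exact le_rfl
  rw [h2, h1, pairSum]
  refine le_trans ?_ (Finset.single_le_sum (f := fun a : Fin 3 × Fin J =>
    ∑ b : Fin 3 × Fin J, if a ≠ b then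
    tiltedMean μ U (fun i : Fin 3 × Fin J => P i.2) β (pairFun K Q r (fun j => (0, j)) a b) else 0)
    (fun a _ => Finset.sum_nonneg fun b _ => h0 a b) (Finset.mem_univ c'))
  refine le_trans ?_ (Finset.single_le_sum (fun b _ => h0 c' b) (Finset.mem_univ d'))
  rw [if_pos hne]

lemma abs_tiltedMean_pairFun_mul_le (h : IsGaussianField μ U K v) (hK0 : ∀ x y, 0 ≤ K x y)
    (hQ : Measurable Q) (hQi : Integrable Q (Measure.pi P)) {r : ℝ} (hr : 0 ≤ r)
    {a b c d : Fin 5 × Fin J} (hab : a ≠ b) (hcd : c ≠ d) (β : ℝ) :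
    |tiltedMean μ U (fun i : Fin 5 × Fin J => P i.2) β
      (fun X => pairFun K Q r (fun j => (0, j)) a b X * K (X c) (X d))| ≤
      2 * pairSum μ U K P (r + 1) (fun X => |Q X|) β := by
  have hz : Function.Injective fun j : Fin J => ((0 : Fin 5), j) := fun i j hij =>
    (congrArg Prod.snd hij :)
  have hi := fun s (hs : 0 ≤ s) a b => h.integrable_pairFun (P := fun i : Fin 5 × Fin J => P i.2)
    hK0 hz hQi (r := s) hs a b
  have hi' := fun s (hs : 0 ≤ s) a b => h.integrable_pairFun (P := fun i : Fin 5 × Fin J => P i.2)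
    hK0 hz hQi.abs (r := s) hs a b
  have hr1 : 0 ≤ r + 1 := by linarith
  refine (h.abs_tiltedMean_le (h.integrable_mul_cov (hi r hr a b) c d)
    ((hi' _ hr1 a b).add (hi' _ hr1 c d)) (fun X => ?_) β).trans ?_
  · simp only [pairFun, Pi.add_apply]
    rw [abs_mul, abs_mul, abs_of_nonneg (hK0 (X c) (X d)),
      abs_of_nonneg (Real.rpow_nonneg (hK0 _ _) _), mul_assoc, ← mul_add]
    exact mul_le_mul_of_nonneg_left (rpow_mul_le_add (hK0 _ _) (hK0 _ _) hr) (abs_nonneg _)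
  · refine (h.tiltedMean_add (hi' _ hr1 a b) (hi' _ hr1 c d) β).trans_le ?_
    have h1 := h.tiltedMean_pairFun_le_pairSum (P := P) hK0 hQ.abs (fun X => abs_nonneg (Q X)) (r + 1)
      hab β
    have h2 := h.tiltedMean_pairFun_le_pairSum (P := P) hK0 hQ.abs (fun X => abs_nonneg (Q X)) (r + 1)
      hcd β
    linarith

/-- The derivative of an annealed mean over three layers, divided by `β`, in terms of annealed
means over five layers. -/
def pairGradient (μ : Measure Ω) (U : S → Ω → ℝ) (K : S → S → ℝ) (P : Fin J → Measure S)
    (B : (Fin 3 × Fin J → S) → ℝ) (β : ℝ) : ℝ :=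
  let T := fun c d : Fin 5 × Fin J => tiltedMean μ U (fun i : Fin 5 × Fin J => P i.2) β
    fun X => B (fun i => X (layerUp (layerUp i))) * K (X c) (X d)
  ∑ i : Fin 3 × Fin J,
    ((∑ k : Fin 4 × Fin J, (T (layerUp (layerUp i)) (layerUp k) -
        T (layerUp (layerUp i)) (layerNew k))) -
      ∑ k : Fin 4 × Fin J, (T (layerUp (layerNew i)) (layerUp k) -
        T (layerUp (layerNew i)) (layerNew k)))

/-- The fourth layer replaces the Gibbs average of the field, the fifth the Gibbs averages of the
covariance; the factor `β` comes out of the integration by parts. -/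
lemma hasDerivAt_tiltedMean_layers (h : IsGaussianField μ U K v) {B : (Fin 3 × Fin J → S) → ℝ}
    (hB : Measurable B) (hBi : Integrable B (Measure.pi fun i : Fin 3 × Fin J => P i.2)) (β : ℝ) :
    HasDerivAt (fun β => tiltedMean μ U (fun i : Fin 3 × Fin J => P i.2) β B)
      (β * pairGradient μ U K P B β) β := by
  have h1 := h.hasDerivAt_tiltedMean (P := fun i : Fin 4 × Fin J => P i.2) (f := layerUp)
    (a := layerNew) layerUp_injective layerUp_ne_layerNew (fun _ => rfl) β hB hBi
  refine h1.congr_deriv ?_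
  have hB4 : Measurable fun X : Fin 4 × Fin J → S => B fun i => X (layerUp i) :=
    hB.comp (measurable_comp_index _)
  have hB4i : Integrable (fun X : Fin 4 × Fin J → S => B fun i => X (layerUp i))
      (Measure.pi fun i : Fin 4 × Fin J => P i.2) :=
    (measurePreserving_comp_pi (fun i : Fin 4 × Fin J => P i.2)
      layerUp_injective).integrable_comp_of_integrable hBi
  have h2 := fun j => h.fieldMean_eq (P := fun i : Fin 5 × Fin J => P i.2) (f := layerUp)
    (a := layerNew) layerUp_injective layerUp_ne_layerNew (fun _ => rfl) β hB4 hB4i j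
  rw [pairGradient, Finset.mul_sum]
  refine Finset.sum_congr rfl fun i _ => ?_
  rw [mul_sub]
  exact congrArg₂ (· - ·) (h2 (layerUp i)) (h2 (layerNew i))

/-- Continuity is needed for the one-sided derivative at `θ = 0`, which is obtained as a limit of
derivatives. -/
lemma continuous_pairGradient (h : IsGaussianField μ U K v) {B : (Fin 3 × Fin J → S) → ℝ}
    (hBi : Integrable B (Measure.pi fun i : Fin 3 × Fin J => P i.2)) :
    Continuous (pairGradient μ U K P B) := by
  have hB5 : Integrable (fun X : Fin 5 × Fin J → S => B fun i => X (layerUp (layerUp i)))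
      (Measure.pi fun i : Fin 5 × Fin J => P i.2) :=
    (measurePreserving_comp_pi (fun i : Fin 5 × Fin J => P i.2)
      (layerUp_injective.comp layerUp_injective)).integrable_comp_of_integrable hBi
  have hc := fun c d => h.continuous_tiltedMean (h.integrable_mul_cov hB5 c d)
  unfold pairGradient
  exact continuous_finsetSum _ fun i _ => (continuous_finsetSum _ fun k _ =>
    (hc _ _).sub (hc _ _)).sub (continuous_finsetSum _ fun k _ => (hc _ _).sub (hc _ _))

lemma abs_pairGradient_le (h : IsGaussianField μ U K v) (hK0 : ∀ x y, 0 ≤ K x y)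
    (hQ : Measurable Q) (hQi : Integrable Q (Measure.pi P)) {r : ℝ} (hr : 0 ≤ r)
    {a b : Fin 3 × Fin J} (hab : a ≠ b) (β : ℝ) :
    |pairGradient μ U K P (pairFun K Q r (fun j => (0, j)) a b) β| ≤
      96 * J ^ 2 * pairSum μ U K P (r + 1) (fun X => |Q X|) β := by
  classical
  set M := 2 * pairSum μ U K P (r + 1) (fun X => |Q X|) β with hM
  have hup : Function.Injective fun i : Fin 3 × Fin J => layerUp (layerUp i) :=
    layerUp_injective.comp layerUp_injective
  obtain ⟨T, hT⟩ : ∃ T : Fin 5 × Fin J → Fin 5 × Fin J → ℝ, T = fun c d =>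
    tiltedMean μ U (fun i : Fin 5 × Fin J => P i.2) β fun X =>
      pairFun K Q r (fun j => (0, j)) a b (fun i => X (layerUp (layerUp i))) * K (X c) (X d) :=
    ⟨_, rfl⟩
  have hTM : ∀ c d, c ≠ d → |T c d| ≤ M := fun c d hcd => by
    rw [hT]
    exact h.abs_tiltedMean_pairFun_mul_le hK0 hQ hQi hr (fun hh => hab (hup hh)) hcd β
  -- All diagonal terms equal the mean of the observable times `v`; they have no bound by
  -- off-diagonal terms and must cancel.
  have hTV : ∀ c d, T c c = T d d := fun c d => by
    simp only [hT, h.diag]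
  have hM0 : 0 ≤ M := (abs_nonneg _).trans (hTM _ _ fun hh => hab (hup hh))
  have hsum : pairGradient μ U K P (pairFun K Q r (fun j => (0, j)) a b) β =
      ∑ i : Fin 3 × Fin J,
        ((∑ k : Fin 4 × Fin J, (T (layerUp (layerUp i)) (layerUp k) -
            T (layerUp (layerUp i)) (layerNew k))) -
          ∑ k : Fin 4 × Fin J, (T (layerUp (layerNew i)) (layerUp k) -
            T (layerUp (layerNew i)) (layerNew k))) := by
    rw [hT]
    rfl
  have hterm : ∀ i : Fin 3 × Fin J,
      |(∑ k : Fin 4 × Fin J, (T (layerUp (layerUp i)) (layerUp k) -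
            T (layerUp (layerUp i)) (layerNew k))) -
          ∑ k : Fin 4 × Fin J, (T (layerUp (layerNew i)) (layerUp k) -
            T (layerUp (layerNew i)) (layerNew k))| ≤ 16 * J * M := fun i => by
    -- Regrouping places the two diagonal terms, at `k = layerUp i` and `k = layerNew i`, in the
    -- same difference; the terms with `layerNew k` are never diagonal. Each group contributes at
    -- most `8 J M`.
    have e1 : (∑ k : Fin 4 × Fin J, (T (layerUp (layerUp i)) (layerUp k) -
            T (layerUp (layerUp i)) (layerNew k))) -
          ∑ k : Fin 4 × Fin J, (T (layerUp (layerNew i)) (layerUp k) -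
            T (layerUp (layerNew i)) (layerNew k)) =
        (∑ k : Fin 4 × Fin J, (T (layerUp (layerUp i)) (layerUp k) -
            T (layerUp (layerNew i)) (layerUp k))) -
          ∑ k : Fin 4 × Fin J, (T (layerUp (layerUp i)) (layerNew k) -
            T (layerUp (layerNew i)) (layerNew k)) := by
      simp only [Finset.sum_sub_distrib]
      ring
    have h1 := abs_sum_sub_le_of_diag (κ := Fin 4 × Fin J)
      (t := fun k => T (layerUp (layerUp i)) (layerUp k))
      (t' := fun k => T (layerUp (layerNew i)) (layerUp k)) (a := layerUp i) (a' := layerNew i)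
      rfl (hTV _ _) hM0
      (fun k hk => hTM _ _ fun hh => hk (layerUp_injective hh.symm))
      (fun k hk => hTM _ _ fun hh => hk (layerUp_injective hh.symm))
    have h2 : |∑ k : Fin 4 × Fin J, (T (layerUp (layerUp i)) (layerNew k) -
        T (layerUp (layerNew i)) (layerNew k))| ≤ ∑ _k : Fin 4 × Fin J, (M + M) :=
      (Finset.abs_sum_le_sum_abs _ _).trans (Finset.sum_le_sum fun k _ =>
        (abs_sub _ _).trans (add_le_add (hTM _ _ (layerUp_ne_layerNew _ _))
          (hTM _ _ (layerUp_ne_layerNew _ _))))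
    simp only [Finset.sum_const, Finset.card_univ, Fintype.card_prod, Fintype.card_fin,
      nsmul_eq_mul, Nat.cast_mul, Nat.cast_ofNat] at h1 h2
    rw [e1]
    refine (abs_sub _ _).trans ?_
    linarith
  rw [hsum]
  refine (Finset.abs_sum_le_sum_abs _ _).trans ((Finset.sum_le_sum fun i _ => hterm i).trans ?_)
  simp only [Finset.sum_const, Finset.card_univ, Fintype.card_prod, Fintype.card_fin,
    nsmul_eq_mul, Nat.cast_mul, Nat.cast_ofNat, hM]
  exact le_of_eq (by ring)

/-- The constant is `96 J²` per pair, times the `(3 J)²` pairs of indices. -/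
theorem exists_hasDerivAt_pairSum (h : IsGaussianField μ U K v) (hK0 : ∀ x y, 0 ≤ K x y)
    (hQ : Measurable Q) (hQi : Integrable Q (Measure.pi P)) {r : ℝ} (hr : 0 ≤ r) :
    ∃ D : ℝ → ℝ, Continuous D ∧
      (∀ β, HasDerivAt (pairSum μ U K P r Q) (β * D β) β) ∧
      ∀ β, |D β| ≤ 864 * J ^ 4 * pairSum μ U K P (r + 1) (fun X => |Q X|) β := by
  have hz : Function.Injective fun j : Fin J => ((0 : Fin 3), j) := fun i j hij =>
    (congrArg Prod.snd hij :)
  have hi := fun a b => h.integrable_pairFun (P := fun i : Fin 3 × Fin J => P i.2)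
    hK0 hz hQi hr a b
  have hm := fun a b => h.measurable_pairFun hQ r (fun j : Fin J => ((0 : Fin 3), j)) a b
  refine ⟨fun β => ∑ a : Fin 3 × Fin J, ∑ b : Fin 3 × Fin J, if a ≠ b then
    pairGradient μ U K P (pairFun K Q r (fun j => (0, j)) a b) β else 0, ?_, fun β => ?_,
    fun β => ?_⟩
  · refine continuous_finsetSum _ fun a _ => continuous_finsetSum _ fun b _ => ?_
    split_ifs
    · exact h.continuous_pairGradient (hi a b)
    · exact continuous_const
  · unfold pairSum
    simp only [Finset.mul_sum]
    refine HasDerivAt.fun_sum fun a _ => HasDerivAt.fun_sum fun b _ => ?_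
    split_ifs
    · exact h.hasDerivAt_tiltedMean_layers (hm a b) (hi a b) β
    · simpa using hasDerivAt_const β (0 : ℝ)
  · have hF0 : 0 ≤ pairSum μ U K P (r + 1) (fun X => |Q X|) β :=
      Finset.sum_nonneg fun a _ => Finset.sum_nonneg fun b _ => by
        split_ifs
        · exact tiltedMean_nonneg
            (fun X => mul_nonneg (abs_nonneg _) (Real.rpow_nonneg (hK0 _ _) _)) β
        · exact le_rfl
    have hb : ∀ a b : Fin 3 × Fin J, |if a ≠ b then
        pairGradient μ U K P (pairFun K Q r (fun j => (0, j)) a b) β else 0| ≤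
        96 * J ^ 2 * pairSum μ U K P (r + 1) (fun X => |Q X|) β := fun a b => by
      split_ifs with hab
      · exact h.abs_pairGradient_le hK0 hQ hQi hr hab β
      · rw [abs_zero]
        positivity
    refine (Finset.abs_sum_le_sum_abs _ _).trans ((Finset.sum_le_sum fun a _ =>
      (Finset.abs_sum_le_sum_abs _ _).trans (Finset.sum_le_sum fun b _ => hb a b)).trans ?_)
    simp only [Finset.sum_const, Finset.card_univ, Fintype.card_prod, Fintype.card_fin,
      nsmul_eq_mul, Nat.cast_mul, Nat.cast_ofNat]
    exact le_of_eq (by ring)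

end IsGaussianField

/-! ### The periodized mollifier and the Gaussian field on path space -/

lemma rep_mem (z : Torus) (i : Fin 2) : rep z i ∈ Ico (-1 / 2 : ℝ) (1 / 2) := by
  have h := (AddCircle.equivIco (1 : ℝ) (-1 / 2) (z i)).2
  norm_num at h
  simp only [mem_Ico]
  norm_num
  exact h

lemma coe_rep (z : Torus) (i : Fin 2) : ((rep z i : ℝ) : UnitAddCircle) = z i :=
  (AddCircle.equivIco (1 : ℝ) (-1 / 2)).symm_apply_apply (z i)

lemma rep_eq_of_coe_eq {z : Torus} {i : Fin 2} {x : ℝ} (hx : x ∈ Ico (-1 / 2 : ℝ) (1 / 2))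
    (h : (x : UnitAddCircle) = z i) : rep z i = x := by
  rw [rep, ← h, AddCircle.equivIco_coe_eq]
  norm_num at hx ⊢
  exact hx

variable {ρ : Mollifier} {ε : ℝ}

lemma mollTorus_nonneg (ρ : Mollifier) (ε : ℝ) (z : Torus) : 0 ≤ mollTorus ρ ε z :=
  mul_nonneg (by positivity) (ρ.nonneg _)

lemma mollTorus_eq_zero (h0 : 0 < ε) {z : Torus} {i : Fin 2} (h : ε / 2 ≤ |rep z i|) :
    mollTorus ρ ε z = 0 := by
  suffices hρ : ε⁻¹ • rep z ∉ tsupport ρ.toFun by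
    rw [mollTorus, image_eq_zero_of_notMem_tsupport hρ, mul_zero]
  intro hmem
  have h1 := ρ.support_subset hmem i
  simp only [Pi.smul_apply, smul_eq_mul] at h1
  have h2 : |ε⁻¹ * rep z i| < 1 / 2 := abs_lt.2 ⟨by linarith [h1.1], h1.2⟩
  rw [abs_mul, abs_of_pos (inv_pos.2 h0), inv_mul_lt_iff₀ h0] at h2
  linarith

lemma rep_neg {z : Torus} {i : Fin 2} (h : rep z i ≠ -1 / 2) : rep (-z) i = -rep z i := by
  have hz := rep_mem z i
  refine rep_eq_of_coe_eq ⟨by linarith [hz.2], ?_⟩ ?_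
  · have := lt_of_le_of_ne hz.1 h.symm
    linarith
  · rw [AddCircle.coe_neg, coe_rep]
    rfl

lemma rep_neg_of_eq {z : Torus} {i : Fin 2} (h : rep z i = -1 / 2) : rep (-z) i = -1 / 2 := by
  refine rep_eq_of_coe_eq ⟨le_rfl, by norm_num⟩ ?_
  have h2 := AddCircle.coe_add_period (1 : ℝ) (-1 / 2)
  rw [Pi.neg_apply, ← coe_rep z i, h, ← AddCircle.coe_neg, ← h2]
  norm_num

/-- Negation commutes with the representative except on the cut `-1/2`, where the mollifier vanishes
because `ε < 1`. -/
lemma mollTorus_neg (h0 : 0 < ε) (h1 : ε < 1) (z : Torus) :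
    mollTorus ρ ε (-z) = mollTorus ρ ε z := by
  by_cases h : ∃ i, rep z i = -1 / 2
  · obtain ⟨i, hi⟩ := h
    have : |(-1 / 2 : ℝ)| = 1 / 2 := by norm_num
    rw [mollTorus_eq_zero h0 (i := i), mollTorus_eq_zero h0 (i := i)]
    · rw [hi, this]; linarith
    · rw [rep_neg_of_eq hi, this]; linarith
  · push Not at h
    have : rep (-z) = -rep z := funext fun i => rep_neg (h i)
    rw [mollTorus, this, smul_neg, ρ.even, mollTorus]

lemma continuous_mollTorus (h0 : 0 < ε) (h1 : ε < 1) : Continuous (mollTorus ρ ε) := by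
  refine continuous_iff_continuousAt.2 fun z => ?_
  by_cases h : ∃ i, rep z i = -1 / 2
  · obtain ⟨i, hi⟩ := h
    -- The representative jumps across the cut, but the quotient norm is continuous and bounds it
    -- below, so the mollifier vanishes in a neighbourhood of the cut.
    have hle : ∀ w : Torus, ‖w i‖ ≤ |rep w i| := fun w => by
      conv_lhs => rw [← coe_rep w i]
      exact QuotientAddGroup.norm_mk_le_norm
    have hz : ‖z i‖ = 1 / 2 := by
      have h2 := AddCircle.norm_half_period_eq (1 : ℝ)
      rw [← coe_rep z i, hi, neg_div, AddCircle.coe_neg, norm_neg, h2]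
      norm_num
    have hopen : ∀ᶠ w : Torus in nhds z, ε / 2 < ‖w i‖ :=
      (continuous_norm.comp (continuous_apply i)).continuousAt.eventually
        (lt_mem_nhds (by simp only [Function.comp_apply, hz]; linarith))
    have hev : mollTorus ρ ε =ᶠ[nhds z] fun _ => 0 :=
      hopen.mono fun w hw => mollTorus_eq_zero h0 (hw.le.trans (hle w))
    exact continuousAt_const.congr hev.symm
  · push Not at h
    have hrep : ContinuousAt rep z := by
      refine continuousAt_pi.2 fun i => ?_
      have hne : z i ≠ ((-1 / 2 : ℝ) : UnitAddCircle) := fun hh =>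
        h i (rep_eq_of_coe_eq ⟨le_rfl, by norm_num⟩ hh.symm)
      have h2 := AddCircle.continuousAt_equivIco (1 : ℝ) (-1 / 2) hne
      exact (continuous_subtype_val.continuousAt.comp h2).comp (f := fun w : Torus => w i)
        (continuous_apply i).continuousAt
    exact ((ρ.smooth.continuous.continuousAt).comp (hrep.const_smul ε⁻¹)).const_mul _

variable {t : ℝ≥0}

lemma continuous_integrand (h0 : 0 < ε) (h1 : ε < 1) :
    Continuous (integrand ρ ε : Path t → NoiseSpace t) := by
  have hc := continuous_mollTorus (ρ := ρ) h0 h1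
  let g : Path t → C(Icc (0 : ℝ) t × Torus, ℝ) := fun X =>
    ⟨fun p => mollTorus ρ ε (X p.1 - p.2), by fun_prop⟩
  have hg : Continuous g := by
    refine ContinuousMap.continuous_of_continuous_uncurry _ ?_
    refine hc.comp ?_
    fun_prop
  have heq : (integrand ρ ε : Path t → NoiseSpace t) = fun X =>
      ContinuousMap.toLp 2 ((timeMeasure t).prod (volume : Measure Torus)) ℝ (g X) := by
    funext X
    refine Lp.ext ?_
    filter_upwards [(memLp_integrand ρ ε X).coeFn_toLp,
      ContinuousMap.coeFn_toLp (p := 2) (𝕜 := ℝ) ((timeMeasure t).prod (volume : Measure Torus))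
        (g X)] with p hp1 hp2
    rw [integrand, hp1, hp2]
    rfl
  rw [heq]
  exact (ContinuousLinearMap.continuous _).comp hg

lemma R_nonneg (ρ : Mollifier) (ε : ℝ) (z : Torus) : 0 ≤ R ρ ε z :=
  integral_nonneg fun _ => mul_nonneg (mollTorus_nonneg _ _ _) (mollTorus_nonneg _ _ _)

lemma integral_mollTorus_mul (h0 : 0 < ε) (h1 : ε < 1) (x x' : Torus) :
    ∫ y : Torus, mollTorus ρ ε (x - y) * mollTorus ρ ε (x' - y) = R ρ ε (x - x') := by
  rw [R, ← integral_sub_right_eq_self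
    (fun y : Torus => mollTorus ρ ε y * mollTorus ρ ε (x - x' - y)) x']
  refine integral_congr_ae (.of_forall fun y => ?_)
  simp only
  rw [← mollTorus_neg h0 h1 (x' - y), neg_sub, mul_comm]
  congr 2
  abel

/-- Fubini in time and space; evenness of the mollifier turns the correlation in `y` into the
convolution `R`. Hence the noise covariance is the intersection time. -/
lemma inner_integrand (h0 : 0 < ε) (h1 : ε < 1) (X Y : Path t) :
    inner ℝ (integrand ρ ε X) (integrand ρ ε Y) = intersectionTime ρ ε X Y := by
  rw [L2.inner_def]
  have h2 : ∫ p, inner ℝ ((integrand ρ ε X : NoiseSpace t) p) ((integrand ρ ε Y : NoiseSpace t) p)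
      ∂((timeMeasure t).prod (volume : Measure Torus)) =
      ∫ p : Icc (0 : ℝ) t × Torus, mollTorus ρ ε (X p.1 - p.2) * mollTorus ρ ε (Y p.1 - p.2)
        ∂((timeMeasure t).prod (volume : Measure Torus)) := by
    refine integral_congr_ae ?_
    filter_upwards [(memLp_integrand ρ ε X).coeFn_toLp, (memLp_integrand ρ ε Y).coeFn_toLp]
      with p hp1 hp2
    have e1 : (integrand ρ ε X : NoiseSpace t) p = mollTorus ρ ε (X p.1 - p.2) := hp1
    have e2 : (integrand ρ ε Y : NoiseSpace t) p = mollTorus ρ ε (Y p.1 - p.2) := hp2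
    rw [e1, e2]
    exact mul_comm _ _
  have h3 : Integrable (fun p : Icc (0 : ℝ) t × Torus =>
      mollTorus ρ ε (X p.1 - p.2) * mollTorus ρ ε (Y p.1 - p.2))
      ((timeMeasure t).prod (volume : Measure Torus)) :=
    (memLp_integrand ρ ε X).integrable_mul (memLp_integrand ρ ε Y)
  rw [h2, integral_prod _ h3, intersectionTime]
  simp only [integral_mollTorus_mul h0 h1]

lemma intersectionTime_nonneg (ρ : Mollifier) (ε : ℝ) (X Y : Path t) :
    0 ≤ intersectionTime ρ ε X Y :=
  integral_nonneg fun _ => R_nonneg _ _ _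

lemma isGaussianField_integrand {Ω : Type*} [MeasurableSpace Ω] {μ : Measure Ω}
    {W : NoiseSpace t → Ω → ℝ} (hW : IsWhiteNoise μ W) (h0 : 0 < ε) (h1 : ε < 1) :
    IsGaussianField μ (fun (X : Path t) ω => W (integrand ρ ε X) ω) (intersectionTime ρ ε)
      (intersectionTime ρ ε (0 : Path t) 0).toNNReal where
  measurable := hW.measurable.comp
    (f := fun p : Path t × Ω => (integrand ρ ε p.1, p.2))
    (((continuous_integrand h0 h1).measurable.comp measurable_fst).prodMk measurable_snd)
  gaussian := hW.gaussian.comp_right (integrand ρ ε)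
  mean X := hW.mean _
  covariance X Y := by rw [hW.covariance, inner_integrand h0 h1]
  diag X := by
    rw [Real.coe_toNNReal _ (intersectionTime_nonneg _ _ _ _)]
    simp [intersectionTime]
  continuous := by
    simp only [← inner_integrand h0 h1]
    exact ((continuous_integrand h0 h1).comp continuous_fst).inner
      ((continuous_integrand h0 h1).comp continuous_snd)

/-! ### From `β` to `θ`, and iteration of the differential inequality -/

/-- With `β = √θ / √L` one has `β dβ/dθ = 1 / (2 L)`, so the singularity of the square root cancels.
-/
lemma hasDerivWithinAt_comp_sqrt {f D : ℝ → ℝ} (hD : Continuous D)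
    (hf : ∀ β, HasDerivAt f (β * D β) β) {L : ℝ} (hL : 0 < L) {θ : ℝ} (hθ : 0 ≤ θ) :
    HasDerivWithinAt (fun θ => f (Real.sqrt θ / Real.sqrt L))
      (D (Real.sqrt θ / Real.sqrt L) / (2 * L)) (Ici 0) θ := by
  have hfc : Continuous f := continuous_iff_continuousAt.2 fun β => (hf β).continuousAt
  have hsq : Continuous fun θ => Real.sqrt θ / Real.sqrt L := Real.continuous_sqrt.div_const _
  have hpos : ∀ x, 0 < x → HasDerivAt (fun θ => f (Real.sqrt θ / Real.sqrt L))
      (D (Real.sqrt x / Real.sqrt L) / (2 * L)) x := fun x hx => by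
    have h1 := (Real.hasDerivAt_sqrt hx.ne').div_const (Real.sqrt L)
    have h2 := (hf (Real.sqrt x / Real.sqrt L)).comp x h1
    refine h2.congr_deriv ?_
    have h3 : Real.sqrt x ≠ 0 := (Real.sqrt_pos.2 hx).ne'
    have h4 : Real.sqrt L ≠ 0 := (Real.sqrt_pos.2 hL).ne'
    have h5 : Real.sqrt L ^ 2 = L := Real.sq_sqrt hL.le
    generalize D (Real.sqrt x / Real.sqrt L) = d
    generalize Real.sqrt L = l at h4 h5 ⊢
    subst h5
    field_simp
  rcases hθ.eq_or_lt with rfl | hθ'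
  · refine hasDerivWithinAt_Ici_of_tendsto_deriv (s := Ioi 0)
      (fun x hx => (hpos x hx).differentiableAt.differentiableWithinAt)
      (hfc.comp hsq).continuousWithinAt self_mem_nhdsWithin ?_
    have h1 : Filter.Tendsto (fun x => D (Real.sqrt x / Real.sqrt L) / (2 * L))
        (nhdsWithin 0 (Ioi 0)) (nhds (D (Real.sqrt 0 / Real.sqrt L) / (2 * L))) :=
      ((hD.comp hsq).div_const _).continuousWithinAt
    exact h1.congr' (Filter.eventually_of_mem self_mem_nhdsWithin fun x hx => (hpos x hx).deriv.symm)
  · exact (hpos θ hθ').hasDerivWithinAt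

section Hierarchy

variable {g g' : ℝ → ℝ → ℝ} {C A b : ℝ}

lemma hasDerivAt_pow_div_factorial (C : ℝ) (n : ℕ) (x : ℝ) :
    HasDerivAt (fun x => (C * x) ^ (n + 1) / ((n + 1).factorial : ℝ))
      (C * ((C * x) ^ n / (n.factorial : ℝ))) x := by
  have h := (((hasDerivAt_id x).const_mul C).pow (n + 1)).div_const ((n + 1).factorial : ℝ)
  refine h.congr_deriv ?_
  have : (n.factorial : ℝ) ≠ 0 := by exact_mod_cast n.factorial_ne_zero
  rw [Nat.factorial_succ]
  push_cast
  have h2 : (n : ℝ) + 1 ≠ 0 := by positivity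
  simp
  field_simp

/-- The bound of order `n + 1` for `g r` has derivative `C` times the bound of order `n` for `g (r +
1)` and agrees with `g r` at `0`, so induction and comparison of derivatives suffice. Order `0` is
the a priori bound. -/
lemma hierarchy_le (hC : 0 ≤ C)
    (hd : ∀ r, 0 ≤ r → ∀ θ, 0 ≤ θ → HasDerivWithinAt (g r) (g' r θ) (Ici 0) θ)
    (hg' : ∀ r, 0 ≤ r → ∀ θ, 0 ≤ θ → |g' r θ| ≤ C * g (r + 1) θ)
    (hA : ∀ r, 0 ≤ r → ∀ θ, g r θ ≤ A * b ^ r) (n : ℕ) :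
    ∀ r, 0 ≤ r → ∀ θ, 0 ≤ θ → g r θ ≤
      ∑ j ∈ Finset.range n, (C * θ) ^ j / (j.factorial : ℝ) * g (r + j) 0 +
        (C * θ) ^ n / (n.factorial : ℝ) * (A * b ^ (r + n)) := by
  induction n with
  | zero => intro r hr θ _; simpa using hA r hr θ
  | succ n ih =>
    intro r hr θ hθ
    have hB : ∀ x, HasDerivAt (fun x =>
        ∑ j ∈ Finset.range (n + 1), (C * x) ^ j / (j.factorial : ℝ) * g (r + j) 0 +
          (C * x) ^ (n + 1) / ((n + 1).factorial : ℝ) * (A * b ^ (r + (n + 1 : ℕ))))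
        (C * (∑ j ∈ Finset.range n, (C * x) ^ j / (j.factorial : ℝ) * g (r + 1 + j) 0 +
          (C * x) ^ n / (n.factorial : ℝ) * (A * b ^ (r + 1 + n)))) x := fun x => by
      simp only [Finset.sum_range_succ', pow_zero, Nat.factorial_zero]
      have h1 := HasDerivAt.fun_sum (u := Finset.range n) fun j _ =>
        (hasDerivAt_pow_div_factorial C j x).mul_const (g (r + (j + 1 : ℕ)) 0)
      have h2 := (hasDerivAt_pow_div_factorial C n x).mul_const (A * b ^ (r + (n + 1 : ℕ)))
      refine ((h1.add_const _).add h2).congr_deriv ?_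
      rw [mul_add, Finset.mul_sum]
      congr 1
      · refine Finset.sum_congr rfl fun j _ => ?_
        push_cast
        rw [add_assoc r 1, add_comm (1 : ℝ), mul_assoc]
      · push_cast
        rw [add_assoc r 1, add_comm (1 : ℝ), mul_assoc]
    refine image_le_of_deriv_right_le_deriv_boundary (f := g r) (f' := g' r) (a := 0) (b := θ)
      (fun x hx => ((hd r hr x hx.1).continuousWithinAt).mono Icc_subset_Ici_self)
      (fun x hx => (hd r hr x hx.1).mono (Ici_subset_Ici.2 hx.1)) ?_
      (fun x _ => (hB x).continuousAt.continuousWithinAt)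
      (fun x _ => (hB x).hasDerivWithinAt) (fun x hx => ?_) ⟨hθ, le_rfl⟩
    · simp [Finset.sum_range_succ']
    · refine (le_abs_self _).trans ((hg' r hr x hx.1).trans ?_)
      exact mul_le_mul_of_nonneg_left (ih (r + 1) (by linarith) x hx.1) hC

theorem hierarchy_tsum (hC : 0 ≤ C) (hb : 0 ≤ b)
    (hd : ∀ r, 0 ≤ r → ∀ θ, 0 ≤ θ → HasDerivWithinAt (g r) (g' r θ) (Ici 0) θ)
    (hg' : ∀ r, 0 ≤ r → ∀ θ, 0 ≤ θ → |g' r θ| ≤ C * g (r + 1) θ)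
    (hg0 : ∀ r θ, 0 ≤ g r θ) (hA : ∀ r, 0 ≤ r → ∀ θ, g r θ ≤ A * b ^ r) {r : ℝ} (hr : 0 ≤ r)
    {θ : ℝ} (hθ : 0 ≤ θ) :
    Summable (fun j : ℕ => (C * θ) ^ j / (j.factorial : ℝ) * g (r + j) 0) ∧
      g r θ ≤ ∑' j : ℕ, (C * θ) ^ j / (j.factorial : ℝ) * g (r + j) 0 := by
  have hCθ : 0 ≤ C * θ := mul_nonneg hC hθ
  have hpow : ∀ j : ℕ, (C * θ) ^ j / (j.factorial : ℝ) * (A * b ^ (r + j)) =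
      A * b ^ r * ((C * θ * b) ^ j / (j.factorial : ℝ)) := fun j => by
    rw [Real.rpow_add_of_nonneg hb hr (Nat.cast_nonneg j), Real.rpow_natCast, mul_pow (C * θ) b]
    ring
  have hsum : Summable fun j : ℕ => A * b ^ r * ((C * θ * b) ^ j / (j.factorial : ℝ)) :=
    (Real.summable_pow_div_factorial _).mul_left _
  have h0 : ∀ j : ℕ, 0 ≤ (C * θ) ^ j / (j.factorial : ℝ) * g (r + j) 0 := fun j =>
    mul_nonneg (by positivity) (hg0 _ _)
  have hS : Summable (fun j : ℕ => (C * θ) ^ j / (j.factorial : ℝ) * g (r + j) 0) := by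
    refine Summable.of_nonneg_of_le h0 (fun j => ?_) hsum
    rw [← hpow j]
    exact mul_le_mul_of_nonneg_left (hA _ (by positivity) 0) (by positivity)
  refine ⟨hS, ?_⟩
  have hlim : Filter.Tendsto (fun n : ℕ =>
      (∑' j : ℕ, (C * θ) ^ j / (j.factorial : ℝ) * g (r + j) 0) +
        A * b ^ r * ((C * θ * b) ^ n / (n.factorial : ℝ))) Filter.atTop
      (nhds ((∑' j : ℕ, (C * θ) ^ j / (j.factorial : ℝ) * g (r + j) 0) + 0)) :=
    tendsto_const_nhds.add hsum.tendsto_atTop_zero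
  rw [add_zero] at hlim
  refine ge_of_tendsto' hlim fun n => ?_
  refine (hierarchy_le hC hd hg' hA n r hr θ hθ).trans ?_
  rw [hpow n]
  exact add_le_add (hS.sum_le_tsum _ fun j _ => h0 j) le_rfl

end Hierarchy

/-! ### Return to the tilted path measures -/

lemma tilted_sub_const {S : Type*} [MeasurableSpace S] (P : Measure S) (f : S → ℝ) (c : ℝ) :
    P.tilted (fun x => f x - c) = P.tilted f := by
  unfold Measure.tilted
  congr 1
  funext x
  have h : ∀ y, Real.exp (f y - c) = Real.exp (-c) * Real.exp (f y) := fun y => by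
    rw [← Real.exp_add]; ring_nf
  simp only [h]
  rw [integral_const_mul, mul_div_mul_left _ _ (Real.exp_ne_zero _)]

namespace IsGaussianField

variable {S Ω κ : Type*} [TopologicalSpace S] [MeasurableSpace S] [MeasurableSpace Ω]
  [Fintype κ] {μ : Measure Ω} [IsProbabilityMeasure μ] {U : S → Ω → ℝ} {K : S → S → ℝ}
  {v : ℝ≥0}

lemma tiltedMean_const (h : IsGaussianField μ U K v) {P : κ → Measure S}
    [∀ k, IsProbabilityMeasure (P k)] (c β : ℝ) :
    tiltedMean μ U P β (fun _ => c) = c := by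
  have h1 : tiltedMean μ U P β (fun _ => c) = ∫ _, c ∂μ := by
    refine integral_congr_ae ?_
    filter_upwards [h.ae_isProbabilityMeasure_tilted P β] with ω hω
    rw [← integral_pi_tilted P ((h.measurable_section ω).const_mul β) fun _ => c]
    simp
  rw [h1]
  simp

variable {J : ℕ} {P : Fin J → Measure S} [∀ k, IsProbabilityMeasure (P k)] {Q : (Fin J → S) → ℝ}
  [SecondCountableTopology S] [OpensMeasurableSpace S]

lemma pairSum_le_abs (h : IsGaussianField μ U K v) (hK0 : ∀ x y, 0 ≤ K x y)
    (hQi : Integrable Q (Measure.pi P)) {r : ℝ} (hr : 0 ≤ r) (β : ℝ) :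
    pairSum μ U K P r Q β ≤ pairSum μ U K P r (fun X => |Q X|) β := by
  have hz : Function.Injective fun j : Fin J => ((0 : Fin 3), j) := fun i j hij =>
    (congrArg Prod.snd hij :)
  refine Finset.sum_le_sum fun a _ => Finset.sum_le_sum fun b _ => ?_
  split_ifs
  · exact h.tiltedMean_mono
      (h.integrable_pairFun (P := fun i : Fin 3 × Fin J => P i.2) hK0 hz hQi hr a b)
      (h.integrable_pairFun (P := fun i : Fin 3 × Fin J => P i.2) hK0 hz hQi.abs hr a b)
      (fun X => mul_le_mul_of_nonneg_right (le_abs_self _) (Real.rpow_nonneg (hK0 _ _) _)) β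
  · exact le_rfl

/-- By Cauchy–Schwarz `K ≤ v`; there are `(3 J)²` terms. The bound is geometric in `r` and uniform
in `β`, so the factorials win in the iteration. -/
lemma pairSum_le_of_bound (h : IsGaussianField μ U K v) (hK0 : ∀ x y, 0 ≤ K x y)
    (hQi : Integrable Q (Measure.pi P)) {M : ℝ} (hM : 0 ≤ M) (hQM : ∀ X, Q X ≤ M) {r : ℝ}
    (hr : 0 ≤ r) (β : ℝ) :
    pairSum μ U K P r Q β ≤ 9 * J ^ 2 * M * (v : ℝ) ^ r := by
  have hz : Function.Injective fun j : Fin J => ((0 : Fin 3), j) := fun i j hij =>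
    (congrArg Prod.snd hij :)
  have hle : ∀ a b : Fin 3 × Fin J, (if a ≠ b then
      tiltedMean μ U (fun i : Fin 3 × Fin J => P i.2) β (pairFun K Q r (fun j => (0, j)) a b)
      else 0) ≤ M * (v : ℝ) ^ r := fun a b => by
    split_ifs
    · refine (h.tiltedMean_mono
        (h.integrable_pairFun (P := fun i : Fin 3 × Fin J => P i.2) hK0 hz hQi hr a b)
        (integrable_const (M * (v : ℝ) ^ r)) (fun X => ?_) β).trans_eq (h.tiltedMean_const _ _)
      exact mul_le_mul (hQM _) (Real.rpow_le_rpow (hK0 _ _)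
        ((le_abs_self _).trans (h.abs_cov_le _ _)) hr) (Real.rpow_nonneg (hK0 _ _) _) hM
    · positivity
  refine (Finset.sum_le_sum fun a _ => Finset.sum_le_sum fun b _ => hle a b).trans (le_of_eq ?_)
  simp only [Finset.sum_const, Finset.card_univ, Fintype.card_prod, Fintype.card_fin,
    nsmul_eq_mul, Nat.cast_mul, Nat.cast_ofNat]
  ring

end IsGaussianField

lemma pairSum_nonneg {S Ω : Type*} {J : ℕ} [MeasurableSpace S] [MeasurableSpace Ω]
    {μ : Measure Ω} {U : S → Ω → ℝ} {K : S → S → ℝ} (hK0 : ∀ x y, 0 ≤ K x y)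
    {P : Fin J → Measure S} {Q : (Fin J → S) → ℝ} (hQ0 : ∀ X, 0 ≤ Q X) (r β : ℝ) :
    0 ≤ pairSum μ U K P r Q β :=
  Finset.sum_nonneg fun a _ => Finset.sum_nonneg fun b _ => by
    split_ifs
    · exact tiltedMean_nonneg (fun X => mul_nonneg (hQ0 _) (Real.rpow_nonneg (hK0 _ _) _)) β
    · exact le_rfl

section WhiteNoise

variable {Ω : Type*} [MeasurableSpace Ω] {μ : Measure Ω} {ρ : Mollifier}
  {ε : ℝ} {t : ℝ≥0} {W : NoiseSpace t → Ω → ℝ} {J : ℕ} {P : Fin J → Measure (Path t)}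
  [∀ j, IsProbabilityMeasure (P j)]

lemma F_eq_pairSum (hW : IsWhiteNoise μ W) (h0 : 0 < ε) (h1 : ε < 1) (r : ℝ)
    (Q : (Fin J → Path t) → ℝ) (θ : ℝ) :
    F μ W ρ ε P r Q θ = pairSum μ (fun (X : Path t) ω => W (integrand ρ ε X) ω)
      (intersectionTime ρ ε) P r Q (Real.sqrt θ / Real.sqrt |Real.log ε|) := by
  have h := isGaussianField_integrand (ρ := ρ) hW h0 h1
  have hterm : ∀ a b, Fterm μ W ρ ε P a b r Q θ =
      tiltedMean μ (fun (X : Path t) ω => W (integrand ρ ε X) ω)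
        (fun i : Fin 3 × Fin J => P i.2) (Real.sqrt θ / Real.sqrt |Real.log ε|)
        (pairFun (intersectionTime ρ ε) Q r (fun j => (0, j)) a b) := fun a b => by
    rw [Fterm, tiltedMean]
    congr 1
    funext ω
    simp only [tiltedLaw, tilted_sub_const, energy]
    exact integral_pi_tilted (fun i : Fin 3 × Fin J => P i.2)
      ((h.measurable_section ω).const_mul _) _
  simp only [F, pairSum, hterm, Fintype.sum_prod_type]
  refine Finset.sum_congr rfl fun α _ => ?_
  -- The definition of `F` sums over both layers before both labels, whereas `pairSum` sums over
  -- index pairs.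
  rw [Finset.sum_comm]

lemma hasDerivWithinAt_G [IsProbabilityMeasure μ] (hW : IsWhiteNoise μ W) (h0 : 0 < ε)
    (h1 : ε < 1) {Q : (Fin J → Path t) → ℝ} (hQ : Measurable Q)
    (hQi : Integrable Q (Measure.pi P)) {r : ℝ} (hr : 0 ≤ r) :
    ∃ G' : ℝ → ℝ, ∀ θ, 0 ≤ θ → HasDerivWithinAt (G μ W ρ ε P r Q) (G' θ) (Ici 0) θ ∧
      |G' θ| ≤ (432 * J ^ 4 + 1) * G μ W ρ ε P (r + 1) (fun X => |Q X|) θ := by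
  have h := isGaussianField_integrand (ρ := ρ) hW h0 h1
  have hK0 : ∀ X Y : Path t, 0 ≤ intersectionTime ρ ε X Y := intersectionTime_nonneg ρ ε
  have hL : 0 < |Real.log ε| := abs_pos.2 (Real.log_neg h0 h1).ne
  obtain ⟨D, hD, hder, hle⟩ := h.exists_hasDerivAt_pairSum (P := P) hK0 hQ hQi hr
  refine ⟨fun θ => |Real.log ε| ^ (-r) *
    (D (Real.sqrt θ / Real.sqrt |Real.log ε|) / (2 * |Real.log ε|)), fun θ hθ => ⟨?_, ?_⟩⟩
  · have heq : G μ W ρ ε P r Q = fun θ => |Real.log ε| ^ (-r) *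
        pairSum μ (fun (X : Path t) ω => W (integrand ρ ε X) ω) (intersectionTime ρ ε) P r Q
          (Real.sqrt θ / Real.sqrt |Real.log ε|) :=
      funext fun θ => by rw [G, F_eq_pairSum hW h0 h1]
    rw [heq]
    exact (hasDerivWithinAt_comp_sqrt hD hder hL hθ).const_mul _
  · have hβ := hle (Real.sqrt θ / Real.sqrt |Real.log ε|)
    have hF0 := pairSum_nonneg (μ := μ) (U := fun (X : Path t) ω => W (integrand ρ ε X) ω)
      hK0 (P := P) (fun X => abs_nonneg (Q X)) (r + 1) (Real.sqrt θ / Real.sqrt |Real.log ε|)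
    rw [G, F_eq_pairSum hW h0 h1]
    set p := pairSum μ (fun (X : Path t) ω => W (integrand ρ ε X) ω) (intersectionTime ρ ε) P
      (r + 1) (fun X => |Q X|) (Real.sqrt θ / Real.sqrt |Real.log ε|)
    have hpow : |Real.log ε| ^ (-(r + 1)) = |Real.log ε| ^ (-r) / |Real.log ε| := by
      rw [neg_add, ← sub_eq_add_neg, Real.rpow_sub_one hL.ne']
    have hpos : 0 < |Real.log ε| ^ (-r) := Real.rpow_pos_of_pos hL _
    rw [hpow, abs_mul, abs_of_pos hpos, abs_div, abs_of_pos (by positivity : 0 < 2 * |Real.log ε|)]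
    calc |Real.log ε| ^ (-r) * (|D (Real.sqrt θ / Real.sqrt |Real.log ε|)| / (2 * |Real.log ε|))
        ≤ |Real.log ε| ^ (-r) * (864 * J ^ 4 * p / (2 * |Real.log ε|)) := by gcongr
      _ = 432 * J ^ 4 * (|Real.log ε| ^ (-r) / |Real.log ε| * p) := by
        field_simp
        ring
      _ ≤ (432 * J ^ 4 + 1) * (|Real.log ε| ^ (-r) / |Real.log ε| * p) := by
        gcongr
        linarith

end WhiteNoise

end KPZ

end

theorem proposition6p1 (J : ℕ) :
    ∃ C : ℝ, 0 < C ∧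
      ∀ {Ω : Type*} [MeasurableSpace Ω] (μ : Measure Ω) [IsProbabilityMeasure μ]
        (ρ : KPZ.Mollifier) (ε : ℝ) (_ : 0 < ε) (_ : ε < 1) (t : ℝ≥0)
        (W : KPZ.NoiseSpace t → Ω → ℝ) (_ : KPZ.IsWhiteNoise μ W)
        (x : Fin J → KPZ.Torus) (P : Fin J → Measure (KPZ.Path t))
        (_ : ∀ j, KPZ.IsBackwardBrownianLaw t (x j) (P j))
        (Q : (Fin J → KPZ.Path t) → ℝ) (_ : Measurable Q) (r : ℝ) (_ : 0 ≤ r)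
        (θ : ℝ) (_ : 0 ≤ θ),
        (Integrable Q (Measure.pi P) →
          DifferentiableWithinAt ℝ (KPZ.G μ W ρ ε P r Q) (Ici 0) θ ∧
          |derivWithin (KPZ.G μ W ρ ε P r Q) (Ici 0) θ| ≤
            C * KPZ.G μ W ρ ε P (r + 1) (fun X => |Q X|) θ) ∧
        ((∃ M : ℝ, ∀ X, |Q X| ≤ M) →
          Summable (fun j : ℕ =>
            (C * θ) ^ j / (j.factorial : ℝ) * KPZ.G μ W ρ ε P (r + j) (fun X => |Q X|) 0) ∧
          KPZ.G μ W ρ ε P r Q θ ≤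
            ∑' j : ℕ,
              (C * θ) ^ j / (j.factorial : ℝ) * KPZ.G μ W ρ ε P (r + j) (fun X => |Q X|) 0) := by
  -- Half of `864 J⁴`, the half coming from `β dβ/dθ`; the `1` keeps the constant positive when `J =
  -- 0`.
  refine ⟨432 * J ^ 4 + 1, by positivity, ?_⟩
  intro Ω _ μ _ ρ ε h0 h1 t W hW x P hP Q hQ r hr θ hθ
  have hprob : ∀ j, IsProbabilityMeasure (P j) := fun j => (hP j).isProbabilityMeasure
  refine ⟨fun hQi => ?_, fun ⟨M, hM⟩ => ?_⟩
  · obtain ⟨G', hG'⟩ := KPZ.hasDerivWithinAt_G (ρ := ρ) hW h0 h1 hQ hQi hr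
    obtain ⟨hd, hle⟩ := hG' θ hθ
    refine ⟨hd.differentiableWithinAt, ?_⟩
    rwa [hd.derivWithin (uniqueDiffOn_Ici 0 θ hθ)]
  · have hK0 : ∀ X Y : KPZ.Path t, 0 ≤ KPZ.intersectionTime ρ ε X Y :=
      KPZ.intersectionTime_nonneg ρ ε
    have hL : 0 < |Real.log ε| := abs_pos.2 (Real.log_neg h0 h1).ne
    have h := KPZ.isGaussianField_integrand (ρ := ρ) hW h0 h1
    have hM' : ∀ X, |Q X| ≤ |M| := fun X => (hM X).trans (le_abs_self M)
    have hQi : Integrable Q (Measure.pi P) :=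
      Integrable.of_bound hQ.aestronglyMeasurable |M| (.of_forall hM')
    -- For `|Q|` the differential inequality has the same observable on both sides, so it closes
    -- into a hierarchy in the exponent alone; `Q` itself is compared with `|Q|` at the end.
    have hder : ∀ s, 0 ≤ s → ∃ G' : ℝ → ℝ, ∀ θ, 0 ≤ θ →
        HasDerivWithinAt (KPZ.G μ W ρ ε P s fun X => |Q X|) (G' θ) (Ici 0) θ ∧
        |G' θ| ≤ (432 * J ^ 4 + 1) * KPZ.G μ W ρ ε P (s + 1) (fun X => |Q X|) θ :=
      fun s hs => by
        simpa only [abs_abs] using KPZ.hasDerivWithinAt_G (ρ := ρ) hW h0 h1 hQ.abs hQi.abs hs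
    choose! G' hG' using hder
    have key := KPZ.hierarchy_tsum (g := fun s θ => KPZ.G μ W ρ ε P s (fun X => |Q X|) θ)
      (g' := G') (C := 432 * J ^ 4 + 1) (A := 9 * J ^ 2 * |M|)
      (b := (KPZ.intersectionTime ρ ε (0 : KPZ.Path t) 0).toNNReal / |Real.log ε|)
      (by positivity) (by positivity)
      (fun s hs θ hθ => (hG' s hs θ hθ).1) (fun s hs θ hθ => (hG' s hs θ hθ).2)
      (fun s θ => ?_) (fun s hs θ => ?_) hr hθ
    · refine ⟨key.1, le_trans ?_ key.2⟩
      simp only [KPZ.G, KPZ.F_eq_pairSum hW h0 h1]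
      exact mul_le_mul_of_nonneg_left (h.pairSum_le_abs hK0 hQi hr _)
        (Real.rpow_nonneg hL.le _)
    · simp only [KPZ.G, KPZ.F_eq_pairSum hW h0 h1]
      exact mul_nonneg (Real.rpow_nonneg hL.le _)
        (KPZ.pairSum_nonneg hK0 (fun X => abs_nonneg _) _ _)
    · simp only [KPZ.G, KPZ.F_eq_pairSum hW h0 h1]
      refine (mul_le_mul_of_nonneg_left (h.pairSum_le_of_bound hK0 hQi.abs (abs_nonneg M) hM' hs _)
        (Real.rpow_nonneg hL.le _)).trans (le_of_eq ?_)
      rw [Real.div_rpow (NNReal.coe_nonneg _) hL.le, Real.rpow_neg hL.le]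
      ring
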